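/- Let $L/K$ be a finite Galois extension of number fields with group $G$, where $K$ is totally real and $L$ is a CM-field, and let $j\in G$ be complex conjugation. Let $S$ be a finite set of places of $K$ containing $S_\infty\cup S_{\rm ram}$, the archimedean places and the places that ramify in $L$. **Notation.** Write $\zeta(R)$ for the centre of a ring $R$ and identify $\zeta(\mathbb C[G])=\prod_{\chi\in\mathrm{Irr}_{\mathbb C}(G)}\mathbb C$. For each place $v$ of $K$ fix a place $w\mid v$ of $L$; for finite $v$ let $I_w\subseteq G_w$ be the inertia and decomposition groups, $\phi_w\in G_w$ a lift of the Frobenius automorphism and $N(v)$ the norm of $v$. Let $L_S(s,\chi)$ be the meromorphic continuation of the $S$-truncated Artin $L$-function $\prod_{v\notin S}\det(1-N(v)^{-s}\phi_w\mid V_\chi^{I_w})^{-1}$ $(\mathrm{Re}\,s>1)$. Put $$\theta_S=\Big((L_S(0,\chi))_\chi\Big)^\sharp,\qquad \delta_T(0)=\Big(\prod_{v\in T}\det(1-N(v)\phi_w^{-1}\mid V_\chi^{I_w})\Big)_\chi$$ for finite sets $T$ of finite places of $K$, where $\sharp$ is induced by $g\mapsto g^{-1}$. Let $w_L$ be the number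 of roots of unity in $L$ and $\omega_L=\mathrm{nr}(w_L)$, where $\mathrm{nr}$ is the reduced norm of $\mathbb Q[G]$. For disjoint sets $S',T$ of places of $K$ let $E_{L,S'}^T$ be the group of $S'(L)$-units of $L$ that are congruent to $1$ modulo all primes of $L$ above $T$; $\mathrm{Hyp}(S',T)$ means that $S'\supseteq S_\infty\cup S_{\rm ram}$, $S'\cap T=\emptyset$ and $E_{L,S'}^T$ is torsion-free. Let $\mathfrak A_S$ be the $\zeta(\mathbb Z[G])$-module generated by the $\delta_T(0)$ for all finite $T$ with $\mathrm{Hyp}(S,T)$. For $H\in M_n(\mathbb Q[G])$ let $H^*$ be the generalised adjoint matrix: if $\sum_{i=0}^{m}\alpha_iX^i$ is a Wedderburn component of the reduced characteristic polynomial of $H$ ($m$ its degree), then the corresponding component of $H^*$ is $(-1)^{m+1}\sum_{i=1}^{m}\alpha_iH^{i-1}$; thus $HH^*=H^*H=\mathrm{nr}(H)$. Let $$\mathcal H(G)=\{x\in\zeta(\mathbb Z[G]) : xH^*\in M_n(\mathbb Z[G])\ \text{for all } n \text{ and all } H\in M_n(\mathbb Z[G])\}$$ be the denominator ideal. Let $\mathfrak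 M$ be a maximal $\mathbb Z$-order with $\mathbb Z[G]\subseteq\mathfrak M\subseteq\mathbb Q[G]$ and let $\mathcal F(G)=\{x\in\zeta(\mathfrak M): x\mathfrak M\subseteq\mathbb Z[G]\}$ be the central conductor. An anti-unit is an $\epsilon\in L^\times$ with $\epsilon^{1+j}=1$. For $\epsilon\in L^\times$ let $S_\epsilon$ be the set of finite places of $K$ lying below a prime that occurs (with positive or negative exponent) in the factorisation of the fractional ideal $(\epsilon)$. Elements of $\mathbb Z[G]$ act on $L^\times$, on fractional ideals and on the class group $\mathrm{cl}_L$ by exponents. **Conjectures.** For $X\in\{\mathcal H(G),\mathcal F(G)\}$ consider the statements: * $B_X$: for every $x\in X$ one has $x\cdot\mathfrak A_S\,\theta_S\subseteq\mathrm{Ann}_{\zeta(\mathbb Z[G])}(\mathrm{cl}_L)$. * $BS_X$: for every $x\in X$ one has $x\,\omega_L\theta_S\in\zeta(\mathbb Z[G])$, and for every non-zero fractional ideal $\mathfrak a$ of $L$ there is an anti-unit $\epsilon$ such that $\mathfrak a^{x\omega_L\theta_S}=(\epsilon)$ and such that for each finite set $T$ of places of $K$ with $\mathrm{Hyp}(S\cup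 S_\epsilon,T)$ there is an $\epsilon_T\in E_{L,S_\epsilon}^T$ with $\epsilon^{z\delta_T(0)}=\epsilon_T^{z\omega_L}$ for all $z\in X$. The non-abelian Brumer conjecture $B(L/K,S)$ and Brumer–Stark conjecture $BS(L/K,S)$ are $B_X$ and $BS_X$ for $X=\mathcal H(G)$; their weak versions $B_w(L/K,S)$ and $BS_w(L/K,S)$ are $B_X$ and $BS_X$ for $X=\mathcal F(G)$. **Lemma.** $BS(L/K,S)$ implies $B(L/K,S)$, and $BS_w(L/K,S)$ implies $B_w(L/K,S)$. -/

import Mathlib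

noncomputable section

open scoped nonZeroDivisors NumberField Pointwise

namespace NonabelianBrumer

/-! ### Group rings of a finite group and the algebra of irreducible characters -/

section GroupRing

variable (G : Type*) [Group G]

/-- The inclusion `ℤ[G] → ℂ[G]`. -/
def intToComplex : MonoidAlgebra ℤ G →+* MonoidAlgebra ℂ G :=
  MonoidAlgebra.mapRingHom G (Int.castRingHom ℂ)

/-- The inclusion `ℚ[G] → ℂ[G]`. -/
def ratToComplex : MonoidAlgebra ℚ G →+* MonoidAlgebra ℂ G :=
  MonoidAlgebra.mapRingHom G (algebraMap ℚ ℂ)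

/-- The inclusion `ℤ[G] → ℚ[G]`. -/
def intToRat : MonoidAlgebra ℤ G →+* MonoidAlgebra ℚ G :=
  MonoidAlgebra.mapRingHom G (Int.castRingHom ℚ)

/-- The centre `ζ(ℤ[G])`, as a subring of `ℂ[G]`. -/
def intCenter : Subring (MonoidAlgebra ℂ G) :=
  (Subring.center (MonoidAlgebra ℤ G)).map (intToComplex G)

/-- The set `Irr_ℂ(G)` of complex irreducible characters of `G`. -/
def IrrChar : Type _ :=
  {χ : G → ℂ // ∃ (n : ℕ) (ρ : Representation ℂ G (Fin n → ℂ)),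
    ρ.IsIrreducible ∧ ρ.character = χ}

variable {G}

namespace IrrChar

/-- The dimension `χ(1)` of `V_χ`. -/
def dim (χ : IrrChar G) : ℕ := χ.2.choose

/-- A representation `V_χ` with character `χ`. -/
def rep (χ : IrrChar G) : Representation ℂ G (Fin χ.dim → ℂ) := χ.2.choose_spec.choose

instance (χ : IrrChar G) : χ.rep.IsIrreducible := χ.2.choose_spec.choose_spec.1

theorem character_rep (χ : IrrChar G) : χ.rep.character = χ.1 := χ.2.choose_spec.choose_spec.2

theorem pairing [Fintype G] (χ ψ : IrrChar G) :
    ∑ g : G, χ.1 g * ψ.1 g⁻¹ ≠ 0 ↔ χ = ψ := by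
  classical
  have : Invertible (Nat.card G : ℂ) := invertibleOfNonzero (by simp)
  have h := Representation.char_orthonormal χ.rep ψ.rep
  rw [character_rep, character_rep] at h
  constructor
  · intro hne
    by_contra hχ
    rw [if_neg] at h
    · exact hne ((mul_eq_zero.mp h).resolve_left (by simp))
    · rintro ⟨e⟩
      apply hχ
      apply Subtype.ext
      rw [← character_rep, ← character_rep, Representation.char_iso e]
  · rintro rfl h0
    rw [h0, mul_zero, if_pos ⟨Representation.Equiv.refl _⟩] at h
    exact zero_ne_one h

instance [Finite G] : Finite (IrrChar G) := by
  classical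
  have := Fintype.ofFinite G
  have hli : LinearIndependent ℂ (fun χ : IrrChar G => χ.1) := by
    rw [linearIndependent_iff']
    intro s c hc ψ hψ
    have h : ∑ g : G, (∑ χ ∈ s, c χ • χ.1) g * ψ.1 g⁻¹ = 0 := by
      rw [hc]; simp
    simp only [Finset.sum_apply, Pi.smul_apply, smul_eq_mul, Finset.sum_mul] at h
    rw [Finset.sum_comm] at h
    simp only [mul_assoc, ← Finset.mul_sum] at h
    rw [Finset.sum_eq_single ψ] at h
    · exact (mul_eq_zero.mp h).resolve_right ((pairing ψ ψ).mpr rfl)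
    · intro χ _ hne
      have : ∑ g : G, χ.1 g * ψ.1 g⁻¹ = 0 := by
        by_contra h'
        exact hne ((pairing χ ψ).mp h')
      rw [this, mul_zero]
    · exact fun h' => absurd hψ h'
  exact hli.finite

instance [Finite G] : Fintype (IrrChar G) := Fintype.ofFinite _

/-- The primitive central idempotent `e_χ = χ(1)/|G| ∑_g χ(g⁻¹) g` of `ℂ[G]`. -/
def idempotent [Fintype G] (χ : IrrChar G) : MonoidAlgebra ℂ G :=
  ∑ g : G, MonoidAlgebra.single g ((χ.dim : ℂ) / (Fintype.card G : ℂ) * χ.1 g⁻¹)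

end IrrChar

/-- The canonical isomorphism `∏_χ ℂ ≃ ζ(ℂ[G])`: the central element `∑_χ c_χ e_χ`. -/
def ofComponents [Fintype G] (c : IrrChar G → ℂ) : MonoidAlgebra ℂ G :=
  ∑ χ : IrrChar G, c χ • χ.idempotent

/-- The anti-involution `♯` of `ℂ[G]` induced by `g ↦ g⁻¹`. -/
def sharp (x : MonoidAlgebra ℂ G) : MonoidAlgebra ℂ G :=
  MonoidAlgebra.mapDomain (fun g : G => g⁻¹) x

/-- The reduced norm `nr : ℂ[G] → ζ(ℂ[G])`; its `χ`-component is the determinant on `V_χ`.  On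
`ℚ[G]` this is the reduced norm of `ℚ[G]`, as `ℂ` is a splitting field. -/
def reducedNorm [Fintype G] (a : MonoidAlgebra ℂ G) : MonoidAlgebra ℂ G :=
  ofComponents fun χ => LinearMap.det (χ.rep.asAlgebraHom a)

/-- The `χ`-component of the reduced characteristic polynomial of a matrix over `ℂ[G]`: the
characteristic polynomial of the action of `H` on `V_χ ^ n`. -/
def reducedCharpoly {n : ℕ} (H : Matrix (Fin n) (Fin n) (MonoidAlgebra ℂ G)) (χ : IrrChar G) :
    Polynomial ℂ :=
  (Matrix.comp (Fin n) (Fin n) (Fin χ.dim) (Fin χ.dim) ℂ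
    (H.map fun a => LinearMap.toMatrix' (χ.rep.asAlgebraHom a))).charpoly

/-- The generalised adjoint `H*` of a matrix `H` over `ℂ[G]`.  If the `χ`-component of the reduced
characteristic polynomial is `∑_{j ≤ m} α_j X ^ j` with `m` its degree, then the `χ`-component
of `H*` is `(-1) ^ (m + 1) ∑_{1 ≤ j ≤ m} α_j H ^ (j - 1)`. -/
def generalisedAdjoint [Fintype G] {n : ℕ} (H : Matrix (Fin n) (Fin n) (MonoidAlgebra ℂ G)) :
    Matrix (Fin n) (Fin n) (MonoidAlgebra ℂ G) :=
  ∑ χ : IrrChar G, (-1 : ℂ) ^ ((reducedCharpoly H χ).natDegree + 1) •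
    (χ.idempotent • Polynomial.aeval H (reducedCharpoly H χ).divX)

variable (G)

/-- The denominator ideal `𝓗(G)`: all `x ∈ ζ(ℤ[G])` such that `x H* ∈ M_n(ℤ[G])` for all `n` and
all `H ∈ M_n(ℤ[G])`. -/
def denominatorIdeal [Fintype G] : Set (MonoidAlgebra ℂ G) :=
  {x | x ∈ intCenter G ∧ ∀ (n : ℕ) (H : Matrix (Fin n) (Fin n) (MonoidAlgebra ℤ G)) (i j : Fin n),
    x * generalisedAdjoint (H.map (intToComplex G)) i j ∈ (intToComplex G).range}

variable {G}

/-- A `ℤ`-order in `ℚ[G]`: a subring that is finitely generated over `ℤ` and spans `ℚ[G]`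
over `ℚ`. -/
def IsOrder (R : Subring (MonoidAlgebra ℚ G)) : Prop :=
  R.toAddSubgroup.FG ∧ Submodule.span ℚ (R : Set (MonoidAlgebra ℚ G)) = ⊤

/-- A maximal `ℤ`-order in `ℚ[G]` that contains `ℤ[G]`. -/
def IsMaximalOrderOver (M : Subring (MonoidAlgebra ℚ G)) : Prop :=
  IsOrder M ∧ (∀ R : Subring (MonoidAlgebra ℚ G), IsOrder R → M ≤ R → R = M) ∧
    (intToRat G).range ≤ M

/-- The central conductor `𝓕(G)` of the maximal order `M` over `ℤ[G]`: all `x ∈ ζ(M)` with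
`x M ⊆ ℤ[G]`, viewed in `ℂ[G]`. -/
def centralConductor (M : Subring (MonoidAlgebra ℚ G)) : Set (MonoidAlgebra ℂ G) :=
  ratToComplex G '' {x | x ∈ M ∧ (∀ m ∈ M, x * m = m * x) ∧ ∀ m ∈ M, x * m ∈ (intToRat G).range}

/-- For a commutative group `A` with an action of the finite group `G`, the element
`a ^ c = ∏_g g(a) ^ {c_g}` for `c = ∑_g c_g g ∈ ℤ[G]`. -/
def groupRingPow [Fintype G] {A : Type*} [CommGroup A] (act : G → A ≃* A) (a : A)
    (c : MonoidAlgebra ℤ G) : A :=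
  ∏ g : G, act g a ^ c.coeff g

end GroupRing

/-! ### Places, decomposition groups and Artin `L`-functions -/

section Arithmetic

variable (K L : Type*) [Field K] [NumberField K] [Field L] [NumberField L] [Algebra K L]

/-- The finite places of a number field. -/
abbrev FinPlace := IsDedekindDomain.HeightOneSpectrum (𝓞 K)

/-- The places of a number field. -/
abbrev Place := FinPlace K ⊕ NumberField.InfinitePlace K

variable {K L}

/-- The finite place `w` of `L` lies above the finite place `v` of `K`. -/
def Above (w : FinPlace L) (v : FinPlace K) : Prop :=
  w.asIdeal.under (𝓞 K) = v.asIdeal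

theorem exists_above (v : FinPlace K) : ∃ w : FinPlace L, Above w v := by
  obtain ⟨⟨P, hP, hPv⟩⟩ := v.asIdeal.nonempty_primesOver (S := 𝓞 L)
  refine ⟨⟨P, hP, ?_⟩, hPv.over.symm⟩
  rintro rfl
  exact v.ne_bot (by rw [hPv.over]; exact Ideal.under_bot _ _)

variable (L) in
/-- The fixed place `w` of `L` above `v`. -/
def placeAbove (v : FinPlace K) : FinPlace L := (exists_above (L := L) v).choose

instance (w : FinPlace L) : Finite (𝓞 L ⧸ w.asIdeal) :=
  Ideal.finiteQuotientOfFreeOfNeBot w.asIdeal w.ne_bot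

/-- The decomposition group `G_w`. -/
abbrev decompositionGroup (K : Type*) [Field K] [NumberField K] [Algebra K L] (w : FinPlace L) :
    Subgroup (L ≃ₐ[K] L) :=
  MulAction.stabilizer (L ≃ₐ[K] L) w.asIdeal

/-- The inertia subgroup `I_w`. -/
abbrev inertiaGroup (K : Type*) [Field K] [NumberField K] [Algebra K L] (w : FinPlace L) :
    Subgroup (L ≃ₐ[K] L) :=
  w.asIdeal.inertia (L ≃ₐ[K] L)

/-- A lift `φ_w ∈ G_w` of the Frobenius automorphism at `w`. -/
def frobenius (K : Type*) [Field K] [NumberField K] [Algebra K L] [IsGalois K L]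
    (w : FinPlace L) : decompositionGroup K w :=
  ⟨arithFrobAt (𝓞 K) (L ≃ₐ[K] L) w.asIdeal, IsArithFrobAt.arithFrobAt_mem_stabilizer (𝓞 K) (L ≃ₐ[K] L) w.asIdeal⟩

section LocalFactor

variable {V : Type*} [AddCommGroup V] [Module ℂ V] (ρ : Representation ℂ (L ≃ₐ[K] L) V)
  (w : FinPlace L)

/-- The subspace `V ^ {I_w}`. -/
def inertiaInvariants : Submodule ℂ V :=
  Representation.invariants (ρ.comp (inertiaGroup K w).subtype)

theorem mem_inertiaInvariants {x : V} :
    x ∈ inertiaInvariants ρ w ↔ ∀ τ ∈ inertiaGroup K w, ρ τ x = x := by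
  simp [inertiaInvariants, Representation.mem_invariants]

theorem map_mem_inertiaInvariants (σ : decompositionGroup K w) :
    ∀ x ∈ inertiaInvariants ρ w, ρ σ x ∈ inertiaInvariants ρ w := by
  intro x hx
  rw [mem_inertiaInvariants] at hx ⊢
  intro τ hτ
  have h1 : (σ : L ≃ₐ[K] L)⁻¹ * τ * σ ∈ inertiaGroup K w := by
    intro y
    have h2 : τ • ((σ : L ≃ₐ[K] L) • y) - (σ : L ≃ₐ[K] L) • y ∈ w.asIdeal := hτ _
    have h3 : (σ : L ≃ₐ[K] L)⁻¹ • w.asIdeal = w.asIdeal := (σ⁻¹).2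
    have h4 := Ideal.smul_mem_pointwise_smul (σ : L ≃ₐ[K] L)⁻¹ _ _ h2
    rw [h3, smul_sub, inv_smul_smul] at h4
    simpa [mul_smul] using h4
  have h5 := hx _ h1
  have h6 : τ * (σ : L ≃ₐ[K] L) = σ * ((σ : L ≃ₐ[K] L)⁻¹ * τ * σ) := by group
  rw [← Module.End.mul_apply, ← map_mul, h6, map_mul, Module.End.mul_apply, h5]

/-- The action of `σ ∈ G_w` on `V ^ {I_w}`. -/
def onInertiaInvariants (σ : decompositionGroup K w) : Module.End ℂ (inertiaInvariants ρ w) :=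
  (ρ (σ : L ≃ₐ[K] L)).restrict (map_mem_inertiaInvariants ρ w σ)

end LocalFactor

/-- The norm `N(v)` of a finite place. -/
def placeNorm (v : FinPlace K) : ℕ := Nat.card (𝓞 K ⧸ v.asIdeal)

variable [IsGalois K L]

/-- The Euler product `∏_{v ∉ S} det(1 - N(v)^{-s} φ_w | V_χ^{I_w})⁻¹`, which converges
for `Re s > 1`. -/
def eulerProduct (S : Set (Place K)) (χ : IrrChar (L ≃ₐ[K] L)) (s : ℂ) : ℂ :=
  ∏' v : {v : FinPlace K // Sum.inl v ∉ S},
    (LinearMap.det (1 - (placeNorm v.1 : ℂ) ^ (-s) •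
      onInertiaInvariants χ.rep (placeAbove L v.1) (frobenius K (placeAbove L v.1))))⁻¹

open Classical in
/-- The `S`-truncated Artin `L`-function `L_S(s, χ)`: the meromorphic continuation of the Euler
product to the whole complex plane.  It is unique, by the identity theorem and since
meromorphic functions in normal form are determined by their values off a discrete set. -/
def artinL (S : Set (Place K)) (χ : IrrChar (L ≃ₐ[K] L)) : ℂ → ℂ :=
  if h : ∃ F : ℂ → ℂ, MeromorphicNFOn F Set.univ ∧ ∀ s : ℂ, 1 < s.re → F s = eulerProduct S χ s
  then h.choose else 0

variable (L) in
/-- The element `δ_T(s)` of `ζ(ℂ[G])` with components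
`∏_{v ∈ T} det(1 - N(v)^{1-s} φ_w⁻¹ | V_χ^{I_w})`.  (The sets `T` that occur consist of
finite places.) -/
def delta (T : Finset (Place K)) (s : ℂ) : MonoidAlgebra ℂ (L ≃ₐ[K] L) :=
  ofComponents fun χ => ∏ v ∈ T, Sum.elim
    (fun v : FinPlace K => LinearMap.det (1 - (placeNorm v : ℂ) ^ (1 - s) •
      onInertiaInvariants χ.rep (placeAbove L v) (frobenius K (placeAbove L v))⁻¹))
    (fun _ => 1) v

variable (L) in
/-- The `(S, T)`-modified equivariant `L`-function `Θ_{S,T}(s) = δ_T(s) L_S(s)^♯`. -/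
def Theta (S : Set (Place K)) (T : Finset (Place K)) (s : ℂ) : MonoidAlgebra ℂ (L ≃ₐ[K] L) :=
  delta L T s * sharp (ofComponents fun χ => artinL S χ s)

variable (L) in
/-- The Stickelberger element `θ_S^T = Θ_{S,T}(0)`; the element `θ_S` is `stickelberger L S ∅`. -/
def stickelberger (S : Set (Place K)) (T : Finset (Place K)) : MonoidAlgebra ℂ (L ≃ₐ[K] L) :=
  Theta L S T 0

variable (K L) in
/-- The element `ω_L = nr(w_L)`, where `w_L` is the number of roots of unity in `L`. -/
def omega : MonoidAlgebra ℂ (L ≃ₐ[K] L) :=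
  reducedNorm (NumberField.Units.torsionOrder L : MonoidAlgebra ℂ (L ≃ₐ[K] L))

/-! ### `(S, T)`-units and the conjectures -/

variable (K L) in
/-- The set `S_ram ∪ S_∞` of the places of `K` that are archimedean or ramify in `L`. -/
def ramifiedOrInfinite : Set (Place K) :=
  {p | (∃ v : FinPlace K, p = Sum.inl v ∧
      ∃ w : FinPlace L, Above w v ∧ w.asIdeal.ramificationIdx (𝓞 K) ≠ 1) ∨
    ∃ v : NumberField.InfinitePlace K, p = Sum.inr v}

variable (L) in
/-- The finite places in `S(L)`. -/
def finAbove (S : Set (Place K)) : Set (FinPlace L) :=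
  {w | ∃ v : FinPlace K, Sum.inl v ∈ S ∧ Above w v}

variable (L) in
/-- The group `E_{L,S}^T` of the `S(L)`-units `x` of `L` with `x ≡ 1` modulo the product of the
primes in `T(L)`, for disjoint `S` and `T`.  As an `S(L)`-unit is integral at all `w` not
in `S(L)`, the congruence says that `x - 1` has positive valuation at all `w ∈ T(L)`. -/
def stUnits (S T : Set (Place K)) : Set Lˣ :=
  {x | x ∈ (finAbove L S).unit L ∧ ∀ w ∈ finAbove L T, w.valuation L ((x : L) - 1) < 1}

variable (L) in
/-- The hypothesis `Hyp(S, T)`. -/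
def Hyp (S T : Set (Place K)) : Prop :=
  ramifiedOrInfinite K L ⊆ S ∧ Disjoint S T ∧
    ∀ x ∈ stUnits L S T, IsOfFinOrder x → x = 1

variable (K) in
/-- The set `S_ε` of the finite places of `K` below a prime that occurs in the factorisation of the
fractional ideal `(ε)`. -/
def supportBelow (ε : Lˣ) : Set (Place K) :=
  {p | ∃ v : FinPlace K, p = Sum.inl v ∧
    ∃ w : FinPlace L, Above w v ∧ w.valuation L (ε : L) ≠ 1}

variable (L) in
/-- The `ζ(ℤ[G])`-module `𝔄_S` generated by the `δ_T(0)` for all finite `T` with `Hyp(S, T)`. -/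
def deltaModule (S : Set (Place K)) : Submodule (intCenter (L ≃ₐ[K] L))
    (MonoidAlgebra ℂ (L ≃ₐ[K] L)) :=
  Submodule.span _ {d | ∃ T : Finset (Place K), Hyp L S (T : Set (Place K)) ∧ d = delta L T 0}

/-- The action of `G` on `L^×`. -/
def actUnits (σ : L ≃ₐ[K] L) : Lˣ ≃* Lˣ := Units.mapEquiv (σ : L ≃* L)

/-- The action of `G` on the ring of integers of `L`. -/
def actIntegers (σ : L ≃ₐ[K] L) : 𝓞 L ≃+* 𝓞 L := MulSemiringAction.toRingEquiv _ (𝓞 L) σ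

/-- The action of `G` on the group of non-zero fractional ideals of `L`. -/
def actIdeals (σ : L ≃ₐ[K] L) :
    (FractionalIdeal (𝓞 L)⁰ L)ˣ ≃* (FractionalIdeal (𝓞 L)⁰ L)ˣ :=
  Units.mapEquiv (FractionalIdeal.ringEquivOfRingEquiv L L (actIntegers σ)).toMulEquiv

/-- The action of `G` on the class group of `L`. -/
def actClasses (σ : L ≃ₐ[K] L) : ClassGroup (𝓞 L) ≃* ClassGroup (𝓞 L) :=
  ClassGroup.mulEquiv (actIntegers σ)

variable (K L) in
/-- The annihilator of the class group `cl_L` in `ζ(ℤ[G])`. -/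
def classGroupAnnihilator : Set (MonoidAlgebra ℤ (L ≃ₐ[K] L)) :=
  {c | c ∈ Subring.center (MonoidAlgebra ℤ (L ≃ₐ[K] L)) ∧
    ∀ a : ClassGroup (𝓞 L), groupRingPow actClasses a c = 1}

/-- An anti-unit of a CM-field: `ε ^ (1 + j) = 1`. -/
def IsAntiUnit [NumberField.IsCMField L] (ε : Lˣ) : Prop :=
  (ε : L) * NumberField.IsCMField.complexConj L (ε : L) = 1

variable (L) in
/-- The statement of Brumer's conjecture with the elements `x` taken from the set `X`. -/
def BrumerFor (X : Set (MonoidAlgebra ℂ (L ≃ₐ[K] L))) (S : Set (Place K)) : Prop :=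
  ∀ x ∈ X, ∀ a ∈ deltaModule L S, ∃ c ∈ classGroupAnnihilator K L,
    intToComplex _ c = x * (a * stickelberger L S ∅)

variable (L) in
/-- The statement of the Brumer--Stark conjecture with the elements `x` and `z` taken from the
set `X`.  Elements of `ℤ[G]` act by exponents; the elements `c`, `d₁`, `d₂` of `ℤ[G]` below
are the elements `x ω_L θ_S`, `z δ_T(0)` and `z ω_L` of `ℂ[G]`.  That `x ω_L θ_S` is integral is part
of the conjecture; `z δ_T(0)` and `z ω_L` are always integral for `z` in the denominator ideal or
the central conductor, and `d₁`, `d₂` are unique as `ℤ[G] → ℂ[G]` is injective. -/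
def BrumerStarkFor [NumberField.IsCMField L] (X : Set (MonoidAlgebra ℂ (L ≃ₐ[K] L)))
    (S : Set (Place K)) : Prop :=
  ∀ x ∈ X, ∃ c ∈ Subring.center (MonoidAlgebra ℤ (L ≃ₐ[K] L)),
    intToComplex _ c = x * omega K L * stickelberger L S ∅ ∧
    ∀ a : (FractionalIdeal (𝓞 L)⁰ L)ˣ, ∃ ε : Lˣ, IsAntiUnit ε ∧
      groupRingPow actIdeals a c = toPrincipalIdeal (𝓞 L) L ε ∧
      ∀ T : Finset (Place K), Hyp L (S ∪ supportBelow K ε) (T : Set (Place K)) →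
        ∃ εT ∈ stUnits L (supportBelow K ε) (T : Set (Place K)),
          ∀ z ∈ X, ∀ d₁ d₂ : MonoidAlgebra ℤ (L ≃ₐ[K] L),
            intToComplex _ d₁ = z * delta L T 0 → intToComplex _ d₂ = z * omega K L →
              groupRingPow actUnits ε d₁ = groupRingPow actUnits εT d₂

variable (L) in
/-- The non-abelian Brumer conjecture `B(L/K, S)`. -/
def Brumer (S : Set (Place K)) : Prop :=
  BrumerFor L (denominatorIdeal (L ≃ₐ[K] L)) S

variable (L) in
/-- The non-abelian Brumer--Stark conjecture `BS(L/K, S)`. -/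
def BrumerStark [NumberField.IsCMField L] (S : Set (Place K)) : Prop :=
  BrumerStarkFor L (denominatorIdeal (L ≃ₐ[K] L)) S

variable (L) in
/-- The weak Brumer conjecture `B_w(L/K, S)`; `M` is the chosen maximal order. -/
def WeakBrumer (M : Subring (MonoidAlgebra ℚ (L ≃ₐ[K] L))) (S : Set (Place K)) : Prop :=
  BrumerFor L (centralConductor M) S

variable (L) in
/-- The weak Brumer--Stark conjecture `BS_w(L/K, S)`; `M` is the chosen maximal order. -/
def WeakBrumerStark [NumberField.IsCMField L] (M : Subring (MonoidAlgebra ℚ (L ≃ₐ[K] L)))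
    (S : Set (Place K)) : Prop :=
  BrumerStarkFor L (centralConductor M) S

end Arithmetic

end NonabelianBrumer

end

noncomputable section

set_option linter.unusedSectionVars false

open scoped nonZeroDivisors NumberField Pointwise MonoidAlgebra IntermediateField

/-! Fix `x ∈ X` and `T` with `Hyp(S, T)`, and write `c = x ω_L θ_S`, which Brumer–Stark makes an
element of `ℤ[G]`. Two things must be shown: `x δ_T(0) θ_S` is the image of some central `y ∈ ℤ[G]`,
and `y` kills the class group.

The only property of `X` that matters is that it contains all multiples of some positive integer.
Since `δ_T(0)` and `ω_L` lie in `ℚ[G]`, a suitable integer `z = N` in `X` makes `d₁ = z δ_T(0)` and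
`d₂ = z ω_L` integral. If an ideal `𝔞` is prime to `T`, then so is `𝔞^c = (ε)`; hence `Hyp(S ∪ S_ε,
T)` holds, and the conjecture provides `ε_T` with `ε^{d₁} = ε_T^{d₂}`, that is, `𝔞^{d₁ c} =
(ε_T)^{d₂}`.

Integrality: take `𝔞 = w` a prime outside `T(L)` with trivial decomposition group, so that `w`
generates a free `ℤ[G]`-module of ideals. As `ε_T` is an `S_ε`-unit, its ideal is supported on the
orbit of `w`, whence `(ε_T) = w^y` with `y ∈ ℤ[G]`. Comparing exponents gives `d₁ c = d₂ y`, and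
cancelling `N` and the central unit `ω_L` gives `y = x δ_T(0) θ_S`.

Annihilation: every class contains an ideal `𝔞` prime to `T`. The relation now reads `(𝔞^y)^{d₂} =
(η)^{d₂}`. Some `d₃ ∈ ℤ[G]` makes `d₃ d₂` a positive integer, and the group of ideals is
torsion-free, so `𝔞^y = (η)` is principal.

The remaining work is rationality and integrality. An element of `ℂ[G]` fixed by all automorphisms
of `ℂ` lies in `ℚ[G]` (`mem_range_ratToComplex`); this applies to `ω_L`, to `δ_T(0)` and to the
entries of `H*`. The entries of `|G| H*` also have algebraic integers as coefficients, so `|G|` lies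
in `𝓗(G)`. The prime `w` comes from an elementary norm argument (`exists_actPlace_ne`). -/

namespace NonabelianBrumer

/-! ### Field automorphisms of an algebraically closed field of characteristic zero -/

section Automorphisms

variable {F E ι : Type*} [Field F] [Field E] [Algebra F E] [IsAlgClosed E]

/-- An automorphism of the polynomial ring in a transcendence basis extends to the algebraically
closed field. -/
theorem exists_ringEquiv_aeval {v : ι → E} (hv : IsTranscendenceBasis F v)
    (τ : MvPolynomial ι F ≃+* MvPolynomial ι F) :
    ∃ e : E ≃+* E, ∀ p, e (MvPolynomial.aeval v p) = MvPolynomial.aeval v (τ p) := by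
  have := IsAlgClosed.isAlgClosure_of_transcendence_basis v hv
  let a := hv.1.aevalEquiv.toRingEquiv
  refine ⟨IsAlgClosure.equivOfEquiv E E ((a.symm.trans τ).trans a), fun p => ?_⟩
  have h : ∀ q, MvPolynomial.aeval v q = algebraMap (Algebra.adjoin F (Set.range v)) E (a q) :=
    fun q => (hv.1.algebraMap_aevalEquiv q).symm
  rw [h, h, IsAlgClosure.equivOfEquiv_algebraMap]
  simp

/-- The only complex numbers fixed by all field automorphisms are the rational numbers. -/
theorem mem_range_of_forall_ringEquiv [CharZero E] {x : E} (hx : ∀ e : E ≃+* E, e x = x) :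
    x ∈ (algebraMap ℚ E).range := by
  let A := algebraicClosure ℚ E
  by_cases hA : x ∈ A
  · have : IsGalois ℚ A := by
      have : IsAlgClosure ℚ A := algebraicClosure.isAlgClosure ℚ E
      exact IsAlgClosure.isGalois ℚ A
    -- An automorphism of the algebraic closure `A` of `ℚ` in `E` extends to `E`: let it act on the
    -- coefficients of polynomials over `A` in a transcendence basis of `E` over `A`. So `x` is
    -- fixed by the whole Galois group of `A` over `ℚ`.
    obtain ⟨q, hq⟩ := (InfiniteGalois.mem_range_algebraMap_iff_fixed (k := ℚ) (⟨x, hA⟩ : A)).mpr (by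
      intro σ
      obtain ⟨s, hs⟩ := exists_isTranscendenceBasis A E
      obtain ⟨e, he⟩ := exists_ringEquiv_aeval hs (MvPolynomial.mapEquiv s σ.toRingEquiv)
      have h := he (MvPolynomial.C ⟨x, hA⟩)
      simp only [MvPolynomial.mapEquiv_apply, MvPolynomial.map_C, MvPolynomial.aeval_C] at h
      apply Subtype.ext
      exact h.symm.trans (hx e))
    exact ⟨q, by simpa using congrArg Subtype.val hq⟩
  · have hx' : Transcendental ℚ x := fun h => hA (mem_algebraicClosure_iff.mpr h)
    obtain ⟨s, hxs, hs⟩ := exists_isTranscendenceBasis_superset (R := ℚ) (s := {x})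
      ((algebraicIndependent_singleton_iff (R := ℚ) (x := fun i : ({x} : Set E) => (i : E))
        ⟨x, rfl⟩).mpr hx')
    -- A transcendental `x` belongs to a transcendence basis, and the translation `X_i ↦ X_i + 1`
    -- induces an automorphism that sends `x` to `x + 1`.
    obtain ⟨e, he⟩ := exists_ringEquiv_aeval hs (AlgEquiv.ofAlgHom
      (MvPolynomial.aeval fun i => MvPolynomial.X i + 1)
      (MvPolynomial.aeval fun i => MvPolynomial.X i - 1)
      (by ext; simp) (by ext; simp) : MvPolynomial s ℚ ≃ₐ[ℚ] MvPolynomial s ℚ).toRingEquiv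
    have h := he (MvPolynomial.X ⟨x, hxs rfl⟩)
    simp [hx e] at h

end Automorphisms

/-! ### Irreducible characters, their idempotents and separation of `ℂ[G]` -/

section Characters

variable {G : Type*} [Group G]

/-- A semilinear equivariant bijection identifies the lattices of subrepresentations. Semilinearity
is needed for Galois twists of representations. -/
theorem isIrreducible_of_semilinear {k V W : Type*} [Field k] [AddCommGroup V] [Module k V]
    [AddCommGroup W] [Module k W] {ρ : Representation k G V} {τ : Representation k G W}
    (σ : k ≃+* k) (e : V ≃+ W) (hσ : ∀ (c : k) (v : V), e (c • v) = σ c • e v)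
    (he : ∀ g v, e (ρ g v) = τ g (e v)) (h : ρ.IsIrreducible) : τ.IsIrreducible := by
  have hσ' : ∀ (c : k) (w : W), e.symm (c • w) = σ.symm c • e.symm w := fun c w => by
    rw [e.symm_apply_eq, hσ]; simp
  have he' : ∀ g w, e.symm (τ g w) = ρ g (e.symm w) := fun g w => by
    rw [e.symm_apply_eq, he]; simp
  let i : Subrepresentation τ ≃o Subrepresentation ρ :=
    { toFun := fun N =>
        { toSubmodule :=
            { carrier := {v | e v ∈ N.toSubmodule}
              add_mem' := fun ha hb => by
                simp only [Set.mem_ofPred_eq, map_add] at *; exact N.toSubmodule.add_mem ha hb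
              zero_mem' := by simp
              smul_mem' := fun c v hv => by
                simp only [Set.mem_ofPred_eq, hσ] at *; exact N.toSubmodule.smul_mem _ hv }
          apply_mem_toSubmodule := fun g v hv => by
            change e (ρ g v) ∈ N.toSubmodule
            rw [he]; exact N.apply_mem_toSubmodule g hv }
      invFun := fun N =>
        { toSubmodule :=
            { carrier := {w | e.symm w ∈ N.toSubmodule}
              add_mem' := fun ha hb => by
                simp only [Set.mem_ofPred_eq, map_add] at *; exact N.toSubmodule.add_mem ha hb
              zero_mem' := by simp
              smul_mem' := fun c v hv => by
                simp only [Set.mem_ofPred_eq, hσ'] at *; exact N.toSubmodule.smul_mem _ hv }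
          apply_mem_toSubmodule := fun g v hv => by
            change e.symm (τ g v) ∈ N.toSubmodule
            rw [he']; exact N.apply_mem_toSubmodule g hv }
      left_inv := fun N => by
        ext w
        change e (e.symm w) ∈ N.toSubmodule ↔ _
        simp
      right_inv := fun N => by
        ext w
        change e.symm (e w) ∈ N.toSubmodule ↔ _
        simp
      map_rel_iff' := by
        intro N N'
        refine ⟨fun h w hw => ?_, fun h v hv => h hv⟩
        have := h (show e.symm w ∈ _ from (by
          change e (e.symm w) ∈ N.toSubmodule; rw [e.apply_symm_apply]; exact hw))
        change e (e.symm w) ∈ N'.toSubmodule at this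
        rw [e.apply_symm_apply] at this
        exact this }
  exact i.isSimpleOrder_iff.mpr h

theorem conj_asAlgebraHom {k V W : Type*} [Field k] [AddCommGroup V] [Module k V]
    [AddCommGroup W] [Module k W] {ρ : Representation k G V} {τ : Representation k G W}
    (φ : ρ.Equiv τ) (x : MonoidAlgebra k G) :
    φ.conj (ρ.asAlgebraHom x) = τ.asAlgebraHom x := by
  induction x using MonoidAlgebra.induction_linear with
  | zero => simp
  | add x y hx hy => simp only [map_add, hx, hy]
  | single g a =>
    rw [Representation.asAlgebraHom_single, Representation.asAlgebraHom_single, map_smul,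
      Representation.Equiv.conj_apply_self]

namespace IrrChar

theorem one_apply (χ : IrrChar G) : χ.1 1 = χ.dim := by
  rw [← character_rep, Representation.char_one]; simp

theorem dim_ne_zero (χ : IrrChar G) : χ.dim ≠ 0 := by
  intro h
  have : IsEmpty (Fin χ.dim) := by rw [h]; infer_instance
  obtain ⟨x, y, hxy⟩ := (inferInstance : Nontrivial (Subrepresentation χ.rep))
  exact hxy (Subrepresentation.toSubmodule_injective (Subsingleton.elim _ _))

theorem nonempty_equiv [Finite G] {χ : IrrChar G} {V : Type*} [AddCommGroup V] [Module ℂ V]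
    [FiniteDimensional ℂ V] (ρ : Representation ℂ G V) [ρ.IsIrreducible]
    (h : ρ.character = χ.1) : Nonempty (χ.rep.Equiv ρ) := by
  classical
  have := Fintype.ofFinite G
  have : Invertible (Nat.card G : ℂ) := invertibleOfNonzero (by simp)
  have h1 := Representation.char_orthonormal ρ χ.rep
  have h2 := Representation.char_orthonormal χ.rep χ.rep
  rw [if_pos ⟨Representation.Equiv.refl _⟩] at h2
  rw [h, ← character_rep, h2] at h1
  by_contra hn
  rw [if_neg hn] at h1
  exact one_ne_zero h1

theorem exists_equiv [Finite G] {V : Type*} [AddCommGroup V] [Module ℂ V]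
    [FiniteDimensional ℂ V] (ρ : Representation ℂ G V) [hρ : ρ.IsIrreducible] :
    ∃ χ : IrrChar G, Nonempty (χ.rep.Equiv ρ) := by
  let b := Module.finBasis ℂ V
  let ρ' : Representation ℂ G (Fin (Module.finrank ℂ V) → ℂ) :=
    (b.equivFun.conjRingEquiv : _ →* _).comp ρ
  let φ : ρ.Equiv ρ' := Representation.Equiv.mk b.equivFun fun g => by
    ext v
    simp [ρ']
  have : ρ'.IsIrreducible := isIrreducible_of_semilinear (RingEquiv.refl ℂ) b.equivFun.toAddEquiv
    (fun c v => by simp) (fun g v => by simp [ρ']) hρ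
  exact ⟨⟨_, _, ρ', this, rfl⟩, nonempty_equiv ρ (Representation.char_iso φ)⟩

theorem sum_apply_mul_apply_inv [Fintype G] (χ : IrrChar G) :
    ∑ g : G, χ.1 g * χ.1 g⁻¹ = Fintype.card G := by
  classical
  have : Invertible (Nat.card G : ℂ) := invertibleOfNonzero (by simp)
  have h2 := Representation.char_orthonormal χ.rep χ.rep
  rw [if_pos ⟨Representation.Equiv.refl _⟩, character_rep] at h2
  have h3 : (Nat.card G : ℂ) ≠ 0 := by simp
  rw [inv_mul_eq_iff_eq_mul₀ h3] at h2
  simpa using h2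

theorem apply_conj (χ : IrrChar G) (g h : G) : χ.1 (h * g * h⁻¹) = χ.1 g := by
  rw [← character_rep, Representation.char_conj]

theorem idempotent_comm [Fintype G] (χ : IrrChar G) (h : G) :
    MonoidAlgebra.single h 1 * χ.idempotent = χ.idempotent * MonoidAlgebra.single h 1 := by
  simp only [idempotent, Finset.mul_sum, Finset.sum_mul, MonoidAlgebra.single_mul_single, one_mul,
    mul_one]
  refine Fintype.sum_equiv (MulAut.conj h).toEquiv _ _ fun g => ?_
  have h1 : (h * g * h⁻¹)⁻¹ = h * g⁻¹ * h⁻¹ := by group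
  simp [h1, apply_conj]

-- By Schur's lemma the central element `e_χ` acts on `V_ψ` by a scalar, and orthogonality of
-- characters gives its trace.
open Classical in
theorem asAlgebraHom_idempotent [Fintype G] (χ ψ : IrrChar G) :
    ψ.rep.asAlgebraHom χ.idempotent = if χ = ψ then 1 else 0 := by
  let f : Representation.IntertwiningMap ψ.rep ψ.rep :=
    ⟨ψ.rep.asAlgebraHom χ.idempotent, fun g => by
      have := congrArg ψ.rep.asAlgebraHom (χ.idempotent_comm g)
      simp only [map_mul, Representation.asAlgebraHom_single_one] at this
      exact this.symm⟩
  obtain ⟨c, hc⟩ :=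
    (Representation.IsIrreducible.algebraMap_intertwiningMap_bijective_of_isAlgClosed
      (ρ := ψ.rep)).2 f
  have hc' : ψ.rep.asAlgebraHom χ.idempotent = c • 1 := by
    have := congrArg (fun f => f.toLinearMap) hc
    exact this.symm
  have ht := congrArg (LinearMap.trace ℂ _) hc'
  have hG : (Fintype.card G : ℂ) ≠ 0 := by simp
  have hd : (ψ.dim : ℂ) ≠ 0 := by simpa using ψ.dim_ne_zero
  have h1 : LinearMap.trace ℂ _ (ψ.rep.asAlgebraHom χ.idempotent) =
      (χ.dim : ℂ) / (Fintype.card G : ℂ) * ∑ g : G, ψ.1 g * χ.1 g⁻¹ := by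
    simp only [idempotent, map_sum, Representation.asAlgebraHom_single, map_smul, smul_eq_mul,
      Finset.mul_sum]
    refine Finset.sum_congr rfl fun g _ => ?_
    rw [← ψ.character_rep, Representation.character]
    ring
  rw [h1] at ht
  simp only [map_smul, LinearMap.trace_one, Module.finrank_fin_fun, smul_eq_mul] at ht
  rw [hc']
  by_cases h : χ = ψ
  · subst h
    rw [sum_apply_mul_apply_inv, div_mul_cancel₀ _ hG] at ht
    rw [if_pos rfl, ← mul_right_cancel₀ hd ((one_mul _).trans ht), one_smul]
  · have h0 : ∑ g : G, ψ.1 g * χ.1 g⁻¹ = 0 := by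
      by_contra h'
      exact h ((pairing ψ χ).mp h').symm
    rw [h0, mul_zero] at ht
    rw [if_neg h, (mul_eq_zero.mp ht.symm).resolve_right hd, zero_smul]

/-- The irreducible representations separate the elements of `ℂ[G]`. -/
theorem eq_zero_of_asAlgebraHom [Finite G] {x : MonoidAlgebra ℂ G}
    (hx : ∀ χ : IrrChar G, χ.rep.asAlgebraHom x = 0) : x = 0 := by
  have hV : ∀ {V : Type _} [AddCommGroup V] [Module ℂ V] [FiniteDimensional ℂ V]
      (ρ : Representation ℂ G V) [ρ.IsIrreducible], ρ.asAlgebraHom x = 0 := by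
    intro V _ _ _ ρ _
    obtain ⟨χ, ⟨φ⟩⟩ := exists_equiv ρ
    rw [← conj_asAlgebraHom φ, hx, map_zero]
  have : NeZero (Nat.card G : ℂ) := ⟨by simp [Nat.card_pos.ne']⟩
  have hss : IsSemisimpleModule ℂ[G] ℂ[G] := inferInstance
  -- By Maschke's theorem `ℂ[G]` is the sum of its simple left ideals. Each of these is an
  -- irreducible representation, on which `x` acts as zero; taking `y = 1` then gives `x = 0`.
  have key : ∀ y : ℂ[G], x * y = 0 := by
    intro y
    have hy : y ∈ sSup {m : Submodule ℂ[G] ℂ[G] | IsSimpleModule ℂ[G] m} := by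
      rw [IsSemisimpleModule.sSup_simples_eq_top]; trivial
    rw [sSup_eq_iSup', ] at hy
    induction hy using Submodule.iSup_induction' with
    | mem N y hy =>
      have hN : IsSimpleModule ℂ[G] N.1 := N.2
      let ρ : Representation ℂ G N.1 := Representation.ofModule' N.1
      have hρ : ∀ (a : ℂ[G]) (v : N.1), ρ.asAlgebraHom a v = a • v := by
        intro a v
        induction a using MonoidAlgebra.induction_linear with
        | zero => simp
        | add a b ha hb => rw [map_add, LinearMap.add_apply, ha, hb, add_smul]
        | single g c =>
          rw [Representation.asAlgebraHom_single, LinearMap.smul_apply]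
          change c • (MonoidAlgebra.single g 1 : ℂ[G]) • v = _
          rw [← smul_assoc, MonoidAlgebra.smul_single, smul_eq_mul, mul_one]
      have hirr : ρ.IsIrreducible := by
        rw [Representation.irreducible_iff_isSimpleModule_asModule]
        let e : ρ.asModule ≃ₗ[ℂ[G]] N.1 :=
          { ρ.asModuleEquiv with
            map_smul' := fun a v => (ρ.asModuleEquiv_map_smul a v).trans (hρ a _) }
        exact IsSimpleModule.congr e
      have : FiniteDimensional ℂ N.1 := Module.Finite.trans ℂ[G] _
      have h := hρ x ⟨y, hy⟩
      rw [hV ρ] at h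
      exact (congrArg Subtype.val h).symm
    | zero => simp
    | add y z _ _ hy hz => rw [mul_add, hy, hz, add_zero]
  simpa using key 1

end IrrChar

end Characters

/-! ### The centre of `ℂ[G]` in components and the reduced norm -/

section Components

variable {G : Type*} [Group G] [Fintype G]

theorem asAlgebraHom_ofComponents (c : IrrChar G → ℂ) (χ : IrrChar G) :
    χ.rep.asAlgebraHom (ofComponents c) = algebraMap ℂ _ (c χ) := by
  classical
  simp only [ofComponents, map_sum, map_smul, IrrChar.asAlgebraHom_idempotent]
  rw [Finset.sum_eq_single χ]
  · rw [if_pos rfl, Algebra.algebraMap_eq_smul_one]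
  · intro ψ _ h
    rw [if_neg h, smul_zero]
  · simp

theorem eq_of_asAlgebraHom {x y : ℂ[G]}
    (h : ∀ χ : IrrChar G, χ.rep.asAlgebraHom x = χ.rep.asAlgebraHom y) : x = y :=
  sub_eq_zero.mp (IrrChar.eq_zero_of_asAlgebraHom fun χ => by rw [map_sub, h, sub_self])

theorem ofComponents_mul (c d : IrrChar G → ℂ) :
    ofComponents (c * d) = ofComponents c * ofComponents d :=
  eq_of_asAlgebraHom fun χ => by
    simp only [map_mul, asAlgebraHom_ofComponents, Pi.mul_apply]

theorem ofComponents_one : ofComponents (1 : IrrChar G → ℂ) = 1 :=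
  eq_of_asAlgebraHom fun χ => by
    simp only [map_one, asAlgebraHom_ofComponents, Pi.one_apply]

theorem ofComponents_comm (c : IrrChar G → ℂ) (x : ℂ[G]) :
    ofComponents c * x = x * ofComponents c :=
  eq_of_asAlgebraHom fun χ => by
    simp only [map_mul, asAlgebraHom_ofComponents, Algebra.commutes]

theorem reducedNorm_mul (a b : ℂ[G]) : reducedNorm (a * b) = reducedNorm a * reducedNorm b := by
  rw [reducedNorm, reducedNorm, reducedNorm, ← ofComponents_mul]
  congr 1
  ext χ
  simp

theorem reducedNorm_one : reducedNorm (1 : ℂ[G]) = 1 := by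
  refine Eq.trans (congrArg ofComponents (funext fun χ => ?_)) ofComponents_one
  simp

end Components

/-! ### Galois action on characters and rationality in `ℂ[G]` -/

section Twist

variable {G : Type*} [Group G]

/-- The representation obtained by applying a field automorphism to the matrix entries. -/
def twist (σ : ℂ ≃+* ℂ) {n : ℕ} (ρ : Representation ℂ G (Fin n → ℂ)) :
    Representation ℂ G (Fin n → ℂ) where
  toFun g := Matrix.toLin' ((LinearMap.toMatrix' (ρ g)).map σ)
  map_one' := by simp [Module.End.one_eq_id]
  map_mul' g h := by
    rw [map_mul, LinearMap.toMatrix'_mul, ← RingEquiv.coe_toRingHom, Matrix.map_mul,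
      Matrix.toLin'_mul]
    rfl

theorem toMatrix_twist (σ : ℂ ≃+* ℂ) {n : ℕ} (ρ : Representation ℂ G (Fin n → ℂ)) (a : ℂ[G]) :
    LinearMap.toMatrix' ((twist σ ρ).asAlgebraHom (MonoidAlgebra.mapRingHom G (σ : ℂ →+* ℂ) a)) =
      (LinearMap.toMatrix' (ρ.asAlgebraHom a)).map σ := by
  induction a using MonoidAlgebra.induction_linear with
  | zero => ext; simp
  | add a b ha hb =>
    simp only [map_add, ha, hb]
    ext; simp
  | single g c =>
    rw [MonoidAlgebra.mapRingHom_single, Representation.asAlgebraHom_single,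
      Representation.asAlgebraHom_single, map_smul, map_smul]
    ext i j
    simp [twist]

theorem character_twist (σ : ℂ ≃+* ℂ) {n : ℕ} (ρ : Representation ℂ G (Fin n → ℂ)) :
    (twist σ ρ).character = σ ∘ ρ.character := by
  ext g
  change LinearMap.trace ℂ _ _ = σ (LinearMap.trace ℂ _ _)
  rw [LinearMap.trace_eq_matrix_trace ℂ (Pi.basisFun ℂ (Fin n)),
    LinearMap.trace_eq_matrix_trace ℂ (Pi.basisFun ℂ (Fin n)), LinearMap.toMatrix_eq_toMatrix',
    twist]
  simp [Matrix.trace, map_sum]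

theorem isIrreducible_twist (σ : ℂ ≃+* ℂ) {n : ℕ} (ρ : Representation ℂ G (Fin n → ℂ))
    (h : ρ.IsIrreducible) : (twist σ ρ).IsIrreducible := by
  refine isIrreducible_of_semilinear σ (AddEquiv.piCongrRight fun _ => σ.toAddEquiv)
    (fun c v => by ext; simp) (fun g v => ?_) h
  have h1 : ρ g v = (LinearMap.toMatrix' (ρ g)).mulVec v := by
    rw [← Matrix.toLin'_apply, Matrix.toLin'_toMatrix']
  rw [h1]
  ext i
  simp only [twist, MonoidHom.coe_mk, OneHom.coe_mk, Matrix.toLin'_apply]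
  exact RingHom.map_mulVec (σ : ℂ →+* ℂ) _ _ i

/-- The action of the automorphisms of `ℂ` on the irreducible characters. -/
def IrrChar.gal (σ : ℂ ≃+* ℂ) (χ : IrrChar G) : IrrChar G :=
  ⟨σ ∘ χ.1, χ.dim, twist σ χ.rep, isIrreducible_twist σ _ inferInstance, by
    rw [character_twist, IrrChar.character_rep]⟩

theorem IrrChar.gal_bijective [Finite G] (σ : ℂ ≃+* ℂ) :
    Function.Bijective (IrrChar.gal (G := G) σ) := by
  rw [← Finite.injective_iff_bijective]
  intro χ ψ h
  apply Subtype.ext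
  exact σ.injective.comp_left (congrArg Subtype.val h)

theorem IrrChar.dim_gal (σ : ℂ ≃+* ℂ) (χ : IrrChar G) : (χ.gal σ).dim = χ.dim := by
  have h := (χ.gal σ).one_apply
  have h' : (χ.gal σ).1 1 = σ (χ.1 1) := rfl
  rw [h', χ.one_apply, map_natCast] at h
  exact_mod_cast h.symm

/-- The representation `(χ.gal σ).rep` is merely a chosen one with the twisted character. The
equivalence suffices to transport determinants and characteristic polynomials, which are invariant
under conjugation. -/
theorem IrrChar.nonempty_equiv_gal [Finite G] (σ : ℂ ≃+* ℂ) (χ : IrrChar G) :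
    Nonempty ((χ.gal σ).rep.Equiv (twist σ χ.rep)) := by
  have := isIrreducible_twist σ χ.rep inferInstance
  exact nonempty_equiv _ (by rw [character_twist, character_rep]; rfl)

theorem mapRingHom_idempotent [Fintype G] (σ : ℂ ≃+* ℂ) (χ : IrrChar G) :
    MonoidAlgebra.mapRingHom G (σ : ℂ →+* ℂ) χ.idempotent = (χ.gal σ).idempotent := by
  simp only [IrrChar.idempotent, map_sum, MonoidAlgebra.mapRingHom_single, IrrChar.dim_gal]
  simp [IrrChar.gal]

theorem mapRingHom_smul (σ : ℂ →+* ℂ) (c : ℂ) (a : ℂ[G]) :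
    MonoidAlgebra.mapRingHom G σ (c • a) = σ c • MonoidAlgebra.mapRingHom G σ a := by
  ext g
  simp

/-- Automorphisms permute the idempotents, `e_χ ↦ e_{σχ}`, so a Galois-equivariant family of
components merely has its summands permuted. -/
theorem mapRingHom_ofComponents [Fintype G] (σ : ℂ ≃+* ℂ) (c : IrrChar G → ℂ)
    (hc : ∀ χ, c (χ.gal σ) = σ (c χ)) :
    MonoidAlgebra.mapRingHom G (σ : ℂ →+* ℂ) (ofComponents c) = ofComponents c := by
  simp only [ofComponents, map_sum, mapRingHom_smul, mapRingHom_idempotent]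
  refine Fintype.sum_bijective _ (IrrChar.gal_bijective σ) _ _ fun χ => ?_
  rw [hc]; rfl

theorem mem_range_ratToComplex {a : ℂ[G]}
    (h : ∀ σ : ℂ ≃+* ℂ, MonoidAlgebra.mapRingHom G (σ : ℂ →+* ℂ) a = a) :
    a ∈ (ratToComplex G).range := by
  have h1 : ∀ g, a.coeff g ∈ (algebraMap ℚ ℂ).range := fun g =>
    mem_range_of_forall_ringEquiv fun σ => by
      conv_rhs => rw [← h σ]
      simp
  choose f hf using h1
  have : (Function.support f).Finite := a.coeff.hasFiniteSupport.subset fun g hg => by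
    rw [Function.mem_support, ← hf]
    simpa using hg
  refine ⟨MonoidAlgebra.ofCoeff (Finsupp.ofSupportFinite f this), ?_⟩
  ext g
  rw [ratToComplex, MonoidAlgebra.coeff_mapRingHom, MonoidAlgebra.coeff_ofCoeff,
    Finsupp.ofSupportFinite_coe, hf]

theorem det_gal [Finite G] (σ : ℂ ≃+* ℂ) (χ : IrrChar G) (a : ℂ[G]) :
    LinearMap.det ((χ.gal σ).rep.asAlgebraHom (MonoidAlgebra.mapRingHom G (σ : ℂ →+* ℂ) a)) =
      σ (LinearMap.det (χ.rep.asAlgebraHom a)) := by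
  obtain ⟨φ⟩ := χ.nonempty_equiv_gal σ
  rw [← LinearMap.det_conj _ φ.toLinearEquiv]
  have h := conj_asAlgebraHom φ (MonoidAlgebra.mapRingHom G (σ : ℂ →+* ℂ) a)
  rw [LinearEquiv.conj_apply] at h
  erw [h]
  rw [← LinearMap.det_toMatrix', toMatrix_twist, ← LinearMap.det_toMatrix']
  exact (RingHom.map_det (σ : ℂ →+* ℂ) _).symm

theorem mapRingHom_ratToComplex (σ : ℂ ≃+* ℂ) (a : ℚ[G]) :
    MonoidAlgebra.mapRingHom G (σ : ℂ →+* ℂ) (ratToComplex G a) = ratToComplex G a := by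
  ext g
  simp [ratToComplex]

/-- The reduced norm of an element of `ℚ[G]` lies in `ℚ[G]`. -/
theorem reducedNorm_mem_range [Fintype G] (a : ℚ[G]) :
    reducedNorm (ratToComplex G a) ∈ (ratToComplex G).range :=
  mem_range_ratToComplex fun σ => mapRingHom_ofComponents σ _ fun χ => by
    rw [← det_gal, mapRingHom_ratToComplex]

end Twist

/-! ### Characteristic polynomials of integral complex matrices -/

section IntegralMatrices

variable {n : Type*} [Fintype n] [DecidableEq n] {A : Matrix n n ℂ}

/-- Every eigenvalue is a root of the monic integral polynomial that kills `A`, and the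
characteristic polynomial is the product of the factors `X - μ` over the eigenvalues. -/
theorem isIntegral_coeff_charpoly (hA : IsIntegral ℤ A) (i : ℕ) :
    IsIntegral ℤ (A.charpoly.coeff i) := by
  have hroot : ∀ μ ∈ A.charpoly.roots, IsIntegral ℤ μ := by
    intro μ hμ
    obtain ⟨p, hp, hpA⟩ := hA
    refine ⟨p, hp, ?_⟩
    have h1 := Matrix.mem_spectrum_of_isRoot_charpoly (Polynomial.isRoot_of_mem_roots hμ)
    have h2 := spectrum.subset_polynomial_aeval A (p.map (Int.castRingHom ℂ)) ⟨μ, h1, rfl⟩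
    have h3 : Polynomial.aeval A (p.map (Int.castRingHom ℂ)) = 0 := by
      rw [← hpA, ← algebraMap_int_eq, Polynomial.aeval_map_algebraMap, Polynomial.aeval_def]
    rw [h3] at h2
    have : Nontrivial (Matrix n n ℂ) := by
      by_contra h
      rw [not_nontrivial_iff_subsingleton] at h
      exact h1 (isUnit_of_subsingleton _)
    rw [spectrum.zero_eq, Set.mem_singleton_iff] at h2
    exact (Polynomial.eval_map _ _).symm.trans h2
  let := Polynomial.algebra ℤ ℂ
  have h : IsIntegral (Polynomial ℤ) A.charpoly := by
    rw [(IsAlgClosed.splits A.charpoly).eq_prod_roots_of_monic A.charpoly_monic]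
    refine IsIntegral.multiset_prod fun f hf => ?_
    obtain ⟨μ, hμ, rfl⟩ := Multiset.mem_map.mp hf
    refine Polynomial.isIntegral_iff_isIntegral_coeff.mpr fun k => ?_
    rw [Polynomial.coeff_sub, Polynomial.coeff_X, Polynomial.coeff_C]
    refine IsIntegral.sub ?_ ?_
    · split_ifs
      exacts [isIntegral_one, isIntegral_zero]
    · split_ifs
      exacts [hroot μ hμ, isIntegral_zero]
  exact Polynomial.isIntegral_iff_isIntegral_coeff.mp h i

theorem isIntegral_trace (hA : IsIntegral ℤ A) : IsIntegral ℤ A.trace := by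
  cases isEmpty_or_nonempty n
  · simp [Matrix.trace, isIntegral_zero]
  · rw [Matrix.trace_eq_neg_charpoly_coeff]
    exact (isIntegral_coeff_charpoly hA _).neg

end IntegralMatrices

/-! ### Galois equivariance of reduced characteristic polynomials and of `H*` -/

section ReducedCharpoly

variable {G : Type*} [Group G]

/-- A representation on column vectors as a homomorphism from the group ring to matrices. -/
def matrixHom {d : ℕ} (ρ : Representation ℂ G (Fin d → ℂ)) : ℂ[G] →+* Matrix (Fin d) (Fin d) ℂ :=
  (LinearMap.toMatrixAlgEquiv' : _ ≃ₐ[ℂ] Matrix (Fin d) (Fin d) ℂ).toRingEquiv.toRingHom.comp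
    ρ.asAlgebraHom.toRingHom

theorem matrixHom_apply {d : ℕ} (ρ : Representation ℂ G (Fin d → ℂ)) (a : ℂ[G]) :
    matrixHom ρ a = LinearMap.toMatrix' (ρ.asAlgebraHom a) := rfl

/-- The action of matrices over the group ring on powers of a representation. -/
def blockHom {d : ℕ} (ρ : Representation ℂ G (Fin d → ℂ)) (n : ℕ) :
    Matrix (Fin n) (Fin n) ℂ[G] →+* Matrix (Fin n × Fin d) (Fin n × Fin d) ℂ :=
  (Matrix.compRingEquiv (Fin n) (Fin d) ℂ).toRingHom.comp (matrixHom ρ).mapMatrix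

theorem reducedCharpoly_eq {n : ℕ} (H : Matrix (Fin n) (Fin n) ℂ[G]) (χ : IrrChar G) :
    reducedCharpoly H χ = (blockHom χ.rep n H).charpoly := rfl

theorem charpoly_blockHom_of_equiv {d d' : ℕ} {ρ : Representation ℂ G (Fin d → ℂ)}
    {ρ' : Representation ℂ G (Fin d' → ℂ)} (φ : ρ.Equiv ρ') {n : ℕ}
    (H : Matrix (Fin n) (Fin n) ℂ[G]) :
    (blockHom ρ n H).charpoly = (blockHom ρ' n H).charpoly := by
  obtain rfl : d = d' := by simpa using φ.toLinearEquiv.finrank_eq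
  let P : (Matrix (Fin d) (Fin d) ℂ)ˣ :=
    ⟨LinearMap.toMatrix' φ.toLinearEquiv.toLinearMap,
      LinearMap.toMatrix' φ.toLinearEquiv.symm.toLinearMap,
      by rw [← LinearMap.toMatrix'_comp, LinearEquiv.comp_symm, LinearMap.toMatrix'_id],
      by rw [← LinearMap.toMatrix'_comp, LinearEquiv.symm_comp, LinearMap.toMatrix'_id]⟩
  have hP : ∀ a, matrixHom ρ' a = P * matrixHom ρ a * P⁻¹ := by
    intro a
    rw [matrixHom_apply, ← conj_asAlgebraHom φ, LinearEquiv.conj_apply, LinearMap.toMatrix'_comp,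
      LinearMap.toMatrix'_comp, ← matrixHom_apply]
    rfl
  -- The block-diagonal matrix with `n` copies of `P` conjugates one block matrix into the other.
  let Q : (Matrix (Fin n × Fin d) (Fin n × Fin d) ℂ)ˣ :=
    Units.map (((Matrix.compRingEquiv (Fin n) (Fin d) ℂ).toRingHom.comp
      (Matrix.scalar (Fin n)))).toMonoidHom P
  have hQ : blockHom ρ' n H = Q * blockHom ρ n H * Q⁻¹ := by
    have h1 : (matrixHom ρ').mapMatrix H = Matrix.scalar (Fin n) (P : Matrix (Fin d) (Fin d) ℂ) *
        (matrixHom ρ).mapMatrix H *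
          Matrix.scalar (Fin n) ((P⁻¹ : (Matrix (Fin d) (Fin d) ℂ)ˣ) : Matrix (Fin d) (Fin d) ℂ) := by
      ext1 i j
      simp [Matrix.scalar_apply, hP]
    change Matrix.compRingEquiv (Fin n) (Fin d) ℂ ((matrixHom ρ').mapMatrix H) = _
    rw [h1, map_mul, map_mul]
    rfl
  rw [hQ, Matrix.coe_units_inv, Matrix.charpoly_units_conj]

theorem blockHom_twist (σ : ℂ ≃+* ℂ) {d n : ℕ} (ρ : Representation ℂ G (Fin d → ℂ))
    (H : Matrix (Fin n) (Fin n) ℂ[G]) :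
    blockHom (twist σ ρ) n ((MonoidAlgebra.mapRingHom G (σ : ℂ →+* ℂ)).mapMatrix H) =
      (blockHom ρ n H).map σ := by
  ext ⟨i, k⟩ ⟨j, l⟩
  change LinearMap.toMatrix' _ k l = _
  erw [toMatrix_twist]
  rfl

theorem reducedCharpoly_gal [Finite G] (σ : ℂ ≃+* ℂ) {n : ℕ} (H : Matrix (Fin n) (Fin n) ℂ[G])
    (χ : IrrChar G) :
    reducedCharpoly ((MonoidAlgebra.mapRingHom G (σ : ℂ →+* ℂ)).mapMatrix H) (χ.gal σ) =
      (reducedCharpoly H χ).map (σ : ℂ →+* ℂ) := by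
  obtain ⟨φ⟩ := χ.nonempty_equiv_gal σ
  rw [reducedCharpoly_eq, charpoly_blockHom_of_equiv φ, blockHom_twist, reducedCharpoly_eq,
    ← Matrix.charpoly_map]
  rfl

theorem mapRingHom_intToComplex (σ : ℂ ≃+* ℂ) (a : ℤ[G]) :
    MonoidAlgebra.mapRingHom G (σ : ℂ →+* ℂ) (intToComplex G a) = intToComplex G a := by
  ext g
  simp [intToComplex]

theorem mapMatrix_aeval (σ : ℂ ≃+* ℂ) {n : ℕ} (H : Matrix (Fin n) (Fin n) ℂ[G])
    (p : Polynomial ℂ) :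
    (MonoidAlgebra.mapRingHom G (σ : ℂ →+* ℂ)).mapMatrix (Polynomial.aeval H p) =
      Polynomial.aeval ((MonoidAlgebra.mapRingHom G (σ : ℂ →+* ℂ)).mapMatrix H)
        (p.map (σ : ℂ →+* ℂ)) := by
  rw [Polynomial.aeval_def, Polynomial.hom_eval₂, Polynomial.aeval_def, Polynomial.eval₂_map]
  congr 1
  ext c i j g
  simp [Matrix.algebraMap_matrix_apply, apply_ite]

theorem mapMatrix_generalisedAdjoint [Fintype G] (σ : ℂ ≃+* ℂ) {n : ℕ}
    (H : Matrix (Fin n) (Fin n) ℂ[G]) :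
    (MonoidAlgebra.mapRingHom G (σ : ℂ →+* ℂ)).mapMatrix (generalisedAdjoint H) =
      generalisedAdjoint ((MonoidAlgebra.mapRingHom G (σ : ℂ →+* ℂ)).mapMatrix H) := by
  rw [generalisedAdjoint, map_sum, generalisedAdjoint]
  refine Fintype.sum_bijective _ (IrrChar.gal_bijective σ) _ _ fun χ => ?_
  rw [reducedCharpoly_gal, Polynomial.natDegree_map]
  have h1 : ((reducedCharpoly H χ).map (σ : ℂ →+* ℂ)).divX =
      (reducedCharpoly H χ).divX.map (σ : ℂ →+* ℂ) := by
    ext k; simp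
  rw [h1, ← mapMatrix_aeval, ← mapRingHom_idempotent]
  ext1 i j
  simp only [RingHom.mapMatrix_apply, Matrix.map_apply, Matrix.smul_apply, mapRingHom_smul,
    smul_eq_mul, map_mul, map_pow, map_neg, map_one]

end ReducedCharpoly

/-! ### Multiples of `|G|` in the denominator ideal -/

section DenominatorIdeal

variable {G : Type*} [Group G]

/-- The elements of `ℂ[G]` with algebraic integers as coefficients. -/
def integralSubring (G : Type*) [Group G] : Subring ℂ[G] :=
  (MonoidAlgebra.mapRingHom G (algebraMap (integralClosure ℤ ℂ) ℂ)).range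

theorem mem_integralSubring {a : ℂ[G]} :
    a ∈ integralSubring G ↔ ∀ g, IsIntegral ℤ (a.coeff g) := by
  constructor
  · rintro ⟨b, rfl⟩ g
    rw [MonoidAlgebra.coeff_mapRingHom]
    exact (b.coeff g).2
  · intro h
    have : (Function.support fun g => (⟨a.coeff g, h g⟩ : integralClosure ℤ ℂ)).Finite :=
      a.coeff.hasFiniteSupport.subset fun g hg => by
        rw [Function.mem_support] at *
        exact fun h0 => hg (Subtype.ext h0)
    refine ⟨MonoidAlgebra.ofCoeff (Finsupp.ofSupportFinite _ this), ?_⟩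
    ext g
    rw [MonoidAlgebra.coeff_mapRingHom, MonoidAlgebra.coeff_ofCoeff, Finsupp.ofSupportFinite_coe]
    rfl

theorem intToComplex_mem_integralSubring (a : ℤ[G]) : intToComplex G a ∈ integralSubring G :=
  mem_integralSubring.mpr fun g => by
    rw [intToComplex, MonoidAlgebra.coeff_mapRingHom]
    exact isIntegral_algebraMap (R := ℤ) (A := ℂ)

theorem smul_mem_integralSubring {c : ℂ} (hc : IsIntegral ℤ c) {a : ℂ[G]}
    (ha : a ∈ integralSubring G) : c • a ∈ integralSubring G :=
  mem_integralSubring.mpr fun g => hc.mul (mem_integralSubring.mp ha g)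

theorem ratToComplex_mem_range_intToComplex {q : ℚ[G]}
    (h : ratToComplex G q ∈ integralSubring G) : ratToComplex G q ∈ (intToComplex G).range := by
  have h1 : ∀ g, ∃ m : ℤ, (m : ℚ) = q.coeff g := fun g => by
    have h2 := mem_integralSubring.mp h g
    rw [ratToComplex, MonoidAlgebra.coeff_mapRingHom,
      isIntegral_algebraMap_iff (algebraMap ℚ ℂ).injective] at h2
    obtain ⟨m, hm⟩ := IsIntegrallyClosed.isIntegral_iff.mp h2
    exact ⟨m, hm⟩
  choose f hf using h1
  have : (Function.support f).Finite := q.coeff.hasFiniteSupport.subset fun g hg => by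
    rw [Function.mem_support, ← hf]
    simpa using hg
  refine ⟨MonoidAlgebra.ofCoeff (Finsupp.ofSupportFinite f this), ?_⟩
  ext g
  rw [intToComplex, ratToComplex, MonoidAlgebra.coeff_mapRingHom, MonoidAlgebra.coeff_mapRingHom,
    MonoidAlgebra.coeff_ofCoeff, Finsupp.ofSupportFinite_coe, ← hf]
  simp

theorem isIntegral_coeff_reducedCharpoly [Finite G] {n : ℕ} (H : Matrix (Fin n) (Fin n) ℤ[G])
    (χ : IrrChar G) (i : ℕ) :
    IsIntegral ℤ ((reducedCharpoly (H.map (intToComplex G)) χ).coeff i) := by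
  refine isIntegral_coeff_charpoly ?_ i
  have hH : IsIntegral ℤ H := Algebra.IsIntegral.isIntegral H
  exact hH.map ((blockHom χ.rep n).comp (intToComplex G).mapMatrix).toIntAlgHom

theorem IrrChar.isIntegral_apply [Finite G] (χ : IrrChar G) (g : G) : IsIntegral ℤ (χ.1 g) := by
  have h1 : χ.1 g = (matrixHom χ.rep (MonoidAlgebra.single g 1)).trace := by
    rw [matrixHom_apply, Representation.asAlgebraHom_single_one, ← χ.character_rep]
    exact LinearMap.trace_eq_matrix_trace ℂ (Pi.basisFun ℂ _) _
  rw [h1]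
  have hg : IsIntegral ℤ (MonoidAlgebra.single g 1 : ℤ[G]) := Algebra.IsIntegral.isIntegral _
  have := hg.map ((matrixHom χ.rep).comp (intToComplex G)).toIntAlgHom
  refine isIntegral_trace ?_
  simpa [intToComplex] using this

theorem card_mul_idempotent_mem [Fintype G] (χ : IrrChar G) :
    (Fintype.card G : ℂ[G]) * χ.idempotent ∈ integralSubring G := by
  refine mem_integralSubring.mpr fun g => ?_
  classical
  have h : ((Fintype.card G : ℂ[G]) * χ.idempotent).coeff g = χ.dim * χ.1 g⁻¹ := by
    have hG : (Fintype.card G : ℂ) ≠ 0 := by simp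
    rw [← nsmul_eq_mul, MonoidAlgebra.coeff_smul_apply, IrrChar.idempotent,
      MonoidAlgebra.coeff_sum, Finsupp.finsetSum_apply]
    simp only [MonoidAlgebra.coeff_single, Finsupp.single_apply, Finset.sum_ite_eq', Finset.mem_univ, if_true,
      nsmul_eq_mul]
    field_simp
  rw [h]
  exact (isIntegral_algebraMap (R := ℤ) (x := (χ.dim : ℤ))).mul (χ.isIntegral_apply _)

/-- The idempotents `e_χ` are the only source of denominators, and `|G|` clears them: the
coefficients of the reduced characteristic polynomials are algebraic integers because `H` is
integral over `ℤ`. -/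
theorem card_mul_generalisedAdjoint_mem [Fintype G] {n : ℕ} (H : Matrix (Fin n) (Fin n) ℤ[G])
    (i j : Fin n) :
    (Fintype.card G : ℂ[G]) * generalisedAdjoint (H.map (intToComplex G)) i j ∈
      integralSubring G := by
  rw [generalisedAdjoint, Matrix.sum_apply, Finset.mul_sum]
  refine Subring.sum_mem _ fun χ _ => ?_
  rw [Matrix.smul_apply, mul_smul_comm]
  refine smul_mem_integralSubring ((isIntegral_one.neg).pow _) ?_
  rw [Matrix.smul_apply, smul_eq_mul, ← mul_assoc]
  refine Subring.mul_mem _ (card_mul_idempotent_mem χ) ?_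
  rw [Polynomial.aeval_eq_sum_range, Matrix.sum_apply]
  refine Subring.sum_mem _ fun k _ => ?_
  rw [Matrix.smul_apply, Polynomial.coeff_divX]
  refine smul_mem_integralSubring (isIntegral_coeff_reducedCharpoly H χ _) ?_
  have h : (H.map (intToComplex G)) ^ k = (H ^ k).map (intToComplex G) :=
    (map_pow (intToComplex G).mapMatrix H k).symm
  rw [h]
  exact intToComplex_mem_integralSubring _

theorem natCast_mem_intCenter (n : ℕ) : (n : ℂ[G]) ∈ intCenter G :=
  ⟨n, natCast_mem (Subring.center ℤ[G]) n, map_natCast _ n⟩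

/-- The multiples of the group order belong to the denominator ideal. -/
theorem natCast_mem_denominatorIdeal [Fintype G] (k : ℕ) :
    ((Fintype.card G * k : ℕ) : ℂ[G]) ∈ denominatorIdeal G := by
  refine ⟨natCast_mem_intCenter _, fun n H i j => ?_⟩
  rw [mul_comm, Nat.cast_mul, mul_assoc]
  refine Subring.mul_mem _ (natCast_mem _ k) ?_
  obtain ⟨q, hq⟩ := mem_range_ratToComplex (a := generalisedAdjoint (H.map (intToComplex G)) i j)
    fun σ => by
      have h := mapMatrix_generalisedAdjoint σ (H.map (intToComplex G))
      have h1 : (MonoidAlgebra.mapRingHom G (σ : ℂ →+* ℂ)).mapMatrix (H.map (intToComplex G)) =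
          H.map (intToComplex G) := by
        ext1 a b
        exact mapRingHom_intToComplex σ _
      rw [h1] at h
      exact congrFun (congrFun h i) j
  have h2 : (Fintype.card G : ℂ[G]) * generalisedAdjoint (H.map (intToComplex G)) i j =
      ratToComplex G (Fintype.card G * q) := by
    rw [map_mul, map_natCast, hq]
  rw [h2]
  -- Coefficients that are both rational and algebraic integers are integers.
  apply ratToComplex_mem_range_intToComplex
  rw [← h2]
  exact card_mul_generalisedAdjoint_mem H i j

end DenominatorIdeal

/-! ### Clearing denominators; integers in the central conductor -/

section Denominators

variable {G : Type*} [Group G]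

theorem ratToComplex_intToRat (a : ℤ[G]) : ratToComplex G (intToRat G a) = intToComplex G a := by
  ext g
  simp [ratToComplex, intToRat, intToComplex]

theorem intToComplex_injective : Function.Injective (intToComplex G) := by
  intro a b h
  ext g
  have := congrArg (fun x => x.coeff g) h
  simpa [intToComplex] using this

theorem exists_natCast_mul_mem_range (q : ℚ[G]) :
    ∃ n : ℕ, n ≠ 0 ∧ (n : ℚ[G]) * q ∈ (intToRat G).range := by
  induction q using MonoidAlgebra.induction_linear with
  | zero => exact ⟨1, one_ne_zero, by simp⟩
  | add a b ha hb =>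
    obtain ⟨m, hm, hma⟩ := ha
    obtain ⟨n, hn, hnb⟩ := hb
    refine ⟨m * n, mul_ne_zero hm hn, ?_⟩
    have h : ((m * n : ℕ) : ℚ[G]) * (a + b) =
        (n : ℚ[G]) * ((m : ℚ[G]) * a) + (m : ℚ[G]) * ((n : ℚ[G]) * b) := by
      rw [mul_add, ← mul_assoc, ← mul_assoc, ← Nat.cast_mul, ← Nat.cast_mul, mul_comm n m]
    rw [h]
    exact Subring.add_mem _ (Subring.mul_mem _ (natCast_mem _ n) hma)
      (Subring.mul_mem _ (natCast_mem _ m) hnb)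
  | single g c =>
    refine ⟨c.den, c.den_ne_zero, MonoidAlgebra.single g c.num, ?_⟩
    rw [← nsmul_eq_mul, MonoidAlgebra.smul_single, nsmul_eq_mul, mul_comm, Rat.mul_den_eq_num]
    simp [intToRat]

theorem exists_natCast_mul_mem_range_intToComplex {a : ℂ[G]} (ha : a ∈ (ratToComplex G).range) :
    ∃ n : ℕ, n ≠ 0 ∧ (n : ℂ[G]) * a ∈ (intToComplex G).range := by
  obtain ⟨q, rfl⟩ := ha
  obtain ⟨n, hn, b, hb⟩ := exists_natCast_mul_mem_range q
  refine ⟨n, hn, b, ?_⟩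
  rw [← ratToComplex_intToRat, hb, map_mul, map_natCast]

/-- Some positive integer and all its multiples belong to the central conductor. -/
theorem exists_natCast_mem_centralConductor {M : Subring ℚ[G]} (hM : M.toAddSubgroup.FG) :
    ∃ n : ℕ, n ≠ 0 ∧ ∀ k : ℕ, ((n * k : ℕ) : ℂ[G]) ∈ centralConductor M := by
  obtain ⟨s, hs⟩ := hM
  choose f hf hf' using exists_natCast_mul_mem_range (G := G)
  -- The integer is the product of denominators of a finite set of additive generators of `M`.
  refine ⟨∏ a ∈ s, f a, Finset.prod_ne_zero_iff.mpr fun a _ => hf a, fun k => ?_⟩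
  refine ⟨((∏ a ∈ s, f a) * k : ℕ), ⟨natCast_mem M _, fun m _ => (Nat.cast_commute _ m).eq,
    fun m hm => ?_⟩, map_natCast _ _⟩
  have hs' : ∀ a, a ∈ AddSubgroup.closure (s : Set ℚ[G]) ↔ a ∈ M := fun a => by rw [hs]; rfl
  have hm' := (hs' m).mpr hm
  induction hm' using AddSubgroup.closure_induction with
  | mem a ha =>
    obtain ⟨c, hc⟩ : f a ∣ (∏ a ∈ s, f a) * k := (Finset.dvd_prod_of_mem f ha).mul_right k
    rw [hc, mul_comm, Nat.cast_mul, mul_assoc]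
    exact Subring.mul_mem _ (natCast_mem _ c) (hf' a)
  | zero => rw [mul_zero]; exact Subring.zero_mem _
  | add a b ha hb iha ihb =>
    rw [mul_add]
    exact Subring.add_mem _ (iha ((hs' a).mp ha)) (ihb ((hs' b).mp hb))
  | neg a ha iha =>
    rw [mul_neg]
    exact Subring.neg_mem _ (iha ((hs' a).mp ha))

end Denominators

/-! ### Formal properties of group ring exponents -/

section GroupRingPow

variable {G A B : Type*} [Group G] [Fintype G] [CommGroup A] [CommGroup B] {act : G → A ≃* A}

theorem groupRingPow_zero (a : A) : groupRingPow act a 0 = 1 := by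
  simp [groupRingPow]

theorem groupRingPow_add (a : A) (c d : ℤ[G]) :
    groupRingPow act a (c + d) = groupRingPow act a c * groupRingPow act a d := by
  simp [groupRingPow, zpow_add, Finset.prod_mul_distrib]

theorem groupRingPow_single (a : A) (g : G) (n : ℤ) :
    groupRingPow act a (MonoidAlgebra.single g n) = act g a ^ n := by
  classical
  rw [groupRingPow, Finset.prod_eq_single g]
  · simp
  · intro h _ hne
    simp [Finsupp.single_eq_of_ne hne]
  · simp

theorem groupRingPow_one_base (c : ℤ[G]) : groupRingPow act (1 : A) c = 1 := by
  simp [groupRingPow]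

theorem groupRingPow_mul (hact : ∀ g h a, act (g * h) a = act g (act h a)) (a : A) (c d : ℤ[G]) :
    groupRingPow act a (c * d) = groupRingPow act (groupRingPow act a d) c := by
  induction c using MonoidAlgebra.induction_linear with
  | zero => simp [groupRingPow_zero]
  | add c c' hc hc' => rw [add_mul, groupRingPow_add, groupRingPow_add, hc, hc']
  | single g n =>
    rw [groupRingPow_single]
    induction d using MonoidAlgebra.induction_linear with
    | zero => simp [groupRingPow_zero]
    | add d d' hd hd' => rw [mul_add, groupRingPow_add, groupRingPow_add, map_mul, mul_zpow, hd, hd']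
    | single h m =>
      rw [MonoidAlgebra.single_mul_single, groupRingPow_single, groupRingPow_single, hact, map_zpow,
        ← zpow_mul, mul_comm]

theorem groupRingPow_natCast (hact : ∀ a, act 1 a = a) (a : A) (n : ℕ) :
    groupRingPow act a (n : ℤ[G]) = a ^ n := by
  have : (n : ℤ[G]) = MonoidAlgebra.single 1 (n : ℤ) := by
    simp [MonoidAlgebra.natCast_def]
  rw [this, groupRingPow_single, hact, zpow_natCast]

theorem map_groupRingPow {act' : G → B ≃* B} (f : A →* B) (hf : ∀ g a, f (act g a) = act' g (f a))
    (a : A) (c : ℤ[G]) : f (groupRingPow act a c) = groupRingPow act' (f a) c := by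
  simp [groupRingPow, hf]

end GroupRingPow

/-! ### Rationality of `δ_T(0)` and invertibility of `ω_L` -/

section EulerFactors

variable {K L : Type*} [Field K] [NumberField K] [Field L] [NumberField L] [Algebra K L]

/-- The element `1 - n e φ⁻¹` of `ℚ[G]`, where `e` is the idempotent of the inertia group. -/
def eulerElement (w : FinPlace L) (σ : L ≃ₐ[K] L) (n : ℕ) : ℚ[L ≃ₐ[K] L] :=
  1 - (n : ℚ) • (((Nat.card (inertiaGroup K w) : ℚ)⁻¹ •
    ∑ᶠ τ : inertiaGroup K w, MonoidAlgebra.single (τ : L ≃ₐ[K] L) 1) * MonoidAlgebra.single σ 1)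

/-- The averaging operator `E` projects `V` onto the inertia invariants `W`. Hence `1 - n E σ`
restricts to `1 - n σ` on `W` and induces the identity on `V / W`, so its determinant on `V` is the
one wanted. The local factor thereby becomes the determinant of one element of `ℚ[G]`, to which
`det_gal` applies. -/
theorem det_onInertiaInvariants {V : Type*} [AddCommGroup V] [Module ℂ V] [FiniteDimensional ℂ V]
    (ρ : Representation ℂ (L ≃ₐ[K] L) V) (w : FinPlace L) (σ : decompositionGroup K w) (n : ℕ) :
    LinearMap.det (1 - (n : ℂ) • onInertiaInvariants ρ w σ) =
      LinearMap.det (ρ.asAlgebraHom (ratToComplex _ (eulerElement w (σ : L ≃ₐ[K] L) n))) := by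
  classical
  have := Fintype.ofFinite (inertiaGroup K w)
  set W := inertiaInvariants ρ w with hW
  set E : Module.End ℂ V := (Nat.card (inertiaGroup K w) : ℂ)⁻¹ •
    ∑ τ : inertiaGroup K w, ρ (τ : L ≃ₐ[K] L) with hE
  have hcard : (Nat.card (inertiaGroup K w) : ℂ) ≠ 0 := Nat.cast_ne_zero.mpr Nat.card_pos.ne'
  have hEW : ∀ x, E x ∈ W := by
    intro x
    rw [hW, mem_inertiaInvariants]
    intro τ hτ
    rw [hE, LinearMap.smul_apply, map_smul, LinearMap.sum_apply, map_sum]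
    congr 1
    refine Fintype.sum_equiv (Equiv.mulLeft ⟨τ, hτ⟩) _ _ fun τ' => ?_
    rw [← Module.End.mul_apply, ← map_mul]
    rfl
  have hEfix : ∀ x ∈ W, E x = x := by
    intro x hx
    rw [hW, mem_inertiaInvariants] at hx
    rw [hE, LinearMap.smul_apply, LinearMap.sum_apply,
      Finset.sum_congr rfl fun τ _ => hx τ.1 τ.2, Finset.sum_const, Finset.card_univ,
      ← Nat.card_eq_fintype_card, ← Nat.cast_smul_eq_nsmul ℂ, inv_smul_smul₀ hcard]
  have hf : ρ.asAlgebraHom (ratToComplex _ (eulerElement w (σ : L ≃ₐ[K] L) n)) =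
      1 - (n : ℂ) • (E * ρ (σ : L ≃ₐ[K] L)) := by
    have hsmul : ∀ (c : ℚ) (a : ℚ[L ≃ₐ[K] L]),
        ratToComplex _ (c • a) = (c : ℂ) • ratToComplex _ a := by
      intro c a; ext g; simp [ratToComplex]
    have hsingle : ∀ g : L ≃ₐ[K] L, ρ.asAlgebraHom (ratToComplex _ (MonoidAlgebra.single g 1)) =
        ρ g := by
      intro g; simp [ratToComplex]
    rw [eulerElement, finsum_eq_sum_of_fintype, map_sub, map_one, map_sub, map_one, hsmul, map_smul,
      map_mul, map_mul, hsmul, map_smul, map_sum, map_sum, hE]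
    simp only [hsingle]
    push_cast
    rfl
  rw [hf]
  set f : Module.End ℂ V := 1 - (n : ℂ) • (E * ρ (σ : L ≃ₐ[K] L)) with hfdef
  have hfx : ∀ x, f x = x - (n : ℂ) • E (ρ (σ : L ≃ₐ[K] L) x) := fun x => rfl
  have hle : W ≤ W.comap f := fun x hx => by
    rw [Submodule.mem_comap, hfx]
    exact W.sub_mem hx (W.smul_mem _ (hEW _))
  rw [LinearMap.det_eq_det_mul_det W f hle]
  have h1 : f.restrict hle = 1 - (n : ℂ) • onInertiaInvariants ρ w σ := by
    ext x
    rw [LinearMap.coe_restrict_apply, hfx, hEfix _ (map_mem_inertiaInvariants ρ w σ _ x.2)]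
    rfl
  have h2 : W.mapQ W f hle = LinearMap.id := by
    ext x
    simp only [LinearMap.comp_apply, Submodule.mkQ_apply, Submodule.mapQ_apply, LinearMap.id_apply]
    rw [Submodule.Quotient.eq, hfx, sub_sub_cancel_left]
    exact W.neg_mem (W.smul_mem _ (hEW _))
  rw [h1, h2, LinearMap.det_id, mul_one]

variable (K L) in
theorem omega_mem_range : omega K L ∈ (ratToComplex (L ≃ₐ[K] L)).range := by
  have := reducedNorm_mem_range (NumberField.Units.torsionOrder L : ℚ[L ≃ₐ[K] L])
  rwa [map_natCast] at this

theorem omega_comm (x : ℂ[L ≃ₐ[K] L]) : omega K L * x = x * omega K L := ofComponents_comm _ x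

variable (K L) in
theorem exists_omega_inv : ∃ u ∈ (ratToComplex (L ≃ₐ[K] L)).range, u * omega K L = 1 := by
  have hw : ((NumberField.Units.torsionOrder L : ℕ) : ℚ) ≠ 0 :=
    Nat.cast_ne_zero.mpr (NumberField.Units.torsionOrder_ne_zero L)
  refine ⟨_, reducedNorm_mem_range
    (algebraMap ℚ ℚ[L ≃ₐ[K] L] ((NumberField.Units.torsionOrder L : ℕ) : ℚ)⁻¹), ?_⟩
  have h : (NumberField.Units.torsionOrder L : ℂ[L ≃ₐ[K] L]) =
      ratToComplex _ (algebraMap ℚ ℚ[L ≃ₐ[K] L] (NumberField.Units.torsionOrder L : ℕ)) := by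
    rw [map_natCast, map_natCast]
  rw [omega, h, ← reducedNorm_mul, ← map_mul, ← map_mul, inv_mul_cancel₀ hw, map_one, map_one,
    reducedNorm_one]

variable [IsGalois K L]

/-- The element `δ_T(0)` lies in `ℚ[G]`. -/
theorem delta_mem_range (T : Finset (Place K)) :
    delta L T 0 ∈ (ratToComplex (L ≃ₐ[K] L)).range := by
  refine mem_range_ratToComplex fun σ => mapRingHom_ofComponents σ _ fun χ => ?_
  rw [map_prod]
  refine Finset.prod_congr rfl fun v _ => ?_
  rcases v with v | v
  · simp only [Sum.elim_inl, sub_zero, Complex.cpow_one]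
    rw [det_onInertiaInvariants, det_onInertiaInvariants, ← det_gal, mapRingHom_ratToComplex]
  · simp

theorem delta_comm (T : Finset (Place K)) (x : ℂ[L ≃ₐ[K] L]) :
    delta L T 0 * x = x * delta L T 0 := ofComponents_comm _ x

end EulerFactors

/-! ### Multiplicities of primes and the Galois action on ideals -/

section Divisors

variable {K L : Type*} [Field K] [NumberField K] [Field L] [NumberField L] [Algebra K L]

/-- The multiplicity of a prime in a fractional ideal. -/
abbrev ord (w : FinPlace L) (I : (FractionalIdeal (𝓞 L)⁰ L)ˣ) : ℤ :=
  FractionalIdeal.count L w (I : FractionalIdeal (𝓞 L)⁰ L)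

theorem ord_mul (w : FinPlace L) (I J : (FractionalIdeal (𝓞 L)⁰ L)ˣ) :
    ord w (I * J) = ord w I + ord w J := by
  rw [ord, Units.val_mul, FractionalIdeal.count_mul L w I.ne_zero J.ne_zero]

theorem ord_zpow (w : FinPlace L) (I : (FractionalIdeal (𝓞 L)⁰ L)ˣ) (n : ℤ) :
    ord w (I ^ n) = n * ord w I := by
  rw [ord, Units.val_zpow_eq_zpow_val, FractionalIdeal.count_zpow]

theorem ext_ord {I J : (FractionalIdeal (𝓞 L)⁰ L)ˣ} (h : ∀ w, ord w I = ord w J) : I = J := by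
  ext1
  rw [← FractionalIdeal.finprod_heightOneSpectrum_factorization' L I.ne_zero,
    ← FractionalIdeal.finprod_heightOneSpectrum_factorization' L J.ne_zero]
  exact finprod_congr fun w => by rw [show FractionalIdeal.count L w _ = _ from h w]

/-- Multiplicities are integers and determine the ideal, so the group of fractional ideals is
torsion-free. -/
theorem eq_of_pow_eq_pow {I J : (FractionalIdeal (𝓞 L)⁰ L)ˣ} {n : ℕ} (hn : n ≠ 0)
    (h : I ^ n = J ^ n) : I = J := by
  refine ext_ord fun w => ?_
  have := congrArg (ord w) h
  rw [← zpow_natCast, ← zpow_natCast, ord_zpow, ord_zpow] at this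
  exact mul_left_cancel₀ (by exact_mod_cast hn) this

theorem valuation_eq_one_iff (w : FinPlace L) (x : Lˣ) :
    w.valuation L (x : L) = 1 ↔ ord w (toPrincipalIdeal (𝓞 L) L x) = 0 := by
  obtain ⟨a, s, hx⟩ := IsLocalization.exists_mk'_eq (𝓞 L)⁰ (x : L)
  have hs : (s : 𝓞 L) ≠ 0 := nonZeroDivisors.coe_ne_zero s
  have ha : a ≠ 0 := by
    rintro rfl
    rw [IsLocalization.mk'_zero] at hx
    exact x.ne_zero hx.symm
  have h1 : ((toPrincipalIdeal (𝓞 L) L x : (FractionalIdeal (𝓞 L)⁰ L)ˣ) :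
      FractionalIdeal (𝓞 L)⁰ L) = FractionalIdeal.spanSingleton (𝓞 L)⁰
        ((algebraMap (𝓞 L) L) s)⁻¹ * (Ideal.span {a} : Ideal (𝓞 L)) := by
    rw [coe_toPrincipalIdeal, FractionalIdeal.coeIdeal_span_singleton,
      FractionalIdeal.spanSingleton_mul_spanSingleton, ← hx, IsFractionRing.mk'_eq_div,
      div_eq_inv_mul]
  classical
  rw [ord, FractionalIdeal.count_well_defined L w (Units.ne_zero _) h1, ← hx,
    IsDedekindDomain.HeightOneSpectrum.valuation_of_mk',
    IsDedekindDomain.HeightOneSpectrum.intValuation_if_neg _ ha,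
    IsDedekindDomain.HeightOneSpectrum.intValuation_if_neg _ hs, ← WithZero.exp_sub,
    WithZero.exp_eq_one]
  omega

/-- The action of the Galois group on the finite places of `L`. -/
def actPlace (σ : L ≃ₐ[K] L) : FinPlace L ≃ FinPlace L :=
  IsDedekindDomain.HeightOneSpectrum.equivOfRingEquiv (actIntegers σ)

theorem asIdeal_actPlace (σ : L ≃ₐ[K] L) (w : FinPlace L) :
    (actPlace σ w).asIdeal = σ • w.asIdeal := by
  ext x
  rw [Ideal.mem_pointwise_smul_iff_inv_smul_mem]
  rfl

theorem actPlace_mul (σ τ : L ≃ₐ[K] L) (w : FinPlace L) :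
    actPlace (σ * τ) w = actPlace σ (actPlace τ w) := by
  ext1
  simp only [asIdeal_actPlace, mul_smul]

theorem actPlace_one (w : FinPlace L) : actPlace (1 : L ≃ₐ[K] L) w = w := by
  ext1
  rw [asIdeal_actPlace, one_smul]

theorem above_actPlace {w : FinPlace L} {v : FinPlace K} (h : Above w v) (σ : L ≃ₐ[K] L) :
    Above (actPlace σ w) v := by
  rw [Above, ← h]
  ext x
  rw [Ideal.mem_comap, Ideal.mem_comap, asIdeal_actPlace,
    Ideal.mem_pointwise_smul_iff_inv_smul_mem]
  have h1 : σ⁻¹ • algebraMap (𝓞 K) (𝓞 L) x = algebraMap (𝓞 K) (𝓞 L) x := by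
    apply NumberField.RingOfIntegers.ext
    exact (σ⁻¹ : L ≃ₐ[K] L).commutes x
  rw [h1]

theorem exists_actPlace_eq [IsGalois K L] {w w' : FinPlace L} {v : FinPlace K} (h : Above w v)
    (h' : Above w' v) : ∃ σ : L ≃ₐ[K] L, w' = actPlace σ w := by
  have : w.asIdeal.IsPrime := w.isPrime
  have : w'.asIdeal.IsPrime := w'.isPrime
  obtain ⟨σ, hσ⟩ := Algebra.IsInvariant.exists_smul_of_under_eq (𝓞 K) (𝓞 L) (L ≃ₐ[K] L)
    w.asIdeal w'.asIdeal (h.trans h'.symm)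
  exact ⟨σ, by ext1; rw [asIdeal_actPlace, hσ]⟩

theorem ringEquivOfRingEquiv_actIntegers (σ : L ≃ₐ[K] L) (x : L) :
    IsFractionRing.ringEquivOfRingEquiv (actIntegers σ) x = σ x := by
  obtain ⟨a, s, rfl⟩ := IsLocalization.exists_mk'_eq (𝓞 L)⁰ x
  have h : ∀ b : 𝓞 L, IsFractionRing.ringEquivOfRingEquiv (K := L) (L := L) (actIntegers σ)
      (algebraMap (𝓞 L) L b) = σ (algebraMap (𝓞 L) L b) := fun b => by
    rw [IsFractionRing.ringEquivOfRingEquiv_algebraMap]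
    rfl
  rw [IsFractionRing.mk'_eq_div, map_div₀, map_div₀, h, h]

theorem actIdeals_toPrincipalIdeal (σ : L ≃ₐ[K] L) (x : Lˣ) :
    actIdeals σ (toPrincipalIdeal (𝓞 L) L x) = toPrincipalIdeal (𝓞 L) L (actUnits σ x) := by
  ext1
  rw [coe_toPrincipalIdeal]
  change FractionalIdeal.ringEquivOfRingEquiv L L (actIntegers σ)
    ((toPrincipalIdeal (𝓞 L) L x : (FractionalIdeal (𝓞 L)⁰ L)ˣ) : FractionalIdeal (𝓞 L)⁰ L) = _
  rw [coe_toPrincipalIdeal, FractionalIdeal.ringEquivOfRingEquiv_spanSingleton,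
    ringEquivOfRingEquiv_actIntegers]
  rfl

theorem ringEquivOfRingEquiv_coeIdeal (σ : L ≃ₐ[K] L) (w : FinPlace L) :
    FractionalIdeal.ringEquivOfRingEquiv L L (actIntegers σ)
      (w.asIdeal : FractionalIdeal (𝓞 L)⁰ L) = ((actPlace σ w).asIdeal : FractionalIdeal (𝓞 L)⁰ L) := by
  have h := fun b : 𝓞 L => ringEquivOfRingEquiv_actIntegers σ (algebraMap (𝓞 L) L b)
  apply FractionalIdeal.coeToSubmodule_injective
  ext x
  constructor
  · rintro ⟨y, ⟨a, ha, rfl⟩, rfl⟩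
    refine ⟨σ • a, ?_, (h a).symm⟩
    rw [asIdeal_actPlace]
    exact Ideal.smul_mem_pointwise_smul _ _ _ ha
  · rintro ⟨a, ha, rfl⟩
    refine ⟨algebraMap (𝓞 L) L (σ⁻¹ • a), ⟨σ⁻¹ • a, ?_, rfl⟩, (h _).trans ?_⟩
    · rw [asIdeal_actPlace] at ha
      exact Ideal.mem_pointwise_smul_iff_inv_smul_mem.mp ha
    · change algebraMap (𝓞 L) L (σ • σ⁻¹ • a) = _
      rw [smul_inv_smul]
      rfl

theorem ord_actIdeals (σ : L ≃ₐ[K] L) (w : FinPlace L) (I : (FractionalIdeal (𝓞 L)⁰ L)ˣ) :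
    ord (actPlace σ w) (actIdeals σ I) = ord w I := by
  have h1 : (actIdeals σ I : FractionalIdeal (𝓞 L)⁰ L) =
      ∏ᶠ u : FinPlace L, (u.asIdeal : FractionalIdeal (𝓞 L)⁰ L) ^ ord ((actPlace σ).symm u) I := by
    change FractionalIdeal.ringEquivOfRingEquiv L L (actIntegers σ)
      (I : FractionalIdeal (𝓞 L)⁰ L) = _
    conv_lhs => rw [← FractionalIdeal.finprod_heightOneSpectrum_factorization' L I.ne_zero]
    rw [MulEquivClass.map_finprod]
    refine Eq.trans (finprod_congr fun u => ?_) (finprod_comp_equiv (actPlace σ))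
    rw [map_zpow₀, ringEquivOfRingEquiv_coeIdeal, Equiv.symm_apply_apply]
  rw [ord, h1, FractionalIdeal.count_finprod, Equiv.symm_apply_apply]
  exact ((actPlace σ).symm.injective.tendsto_cofinite.eventually
    (FractionalIdeal.finite_factors (I : FractionalIdeal (𝓞 L)⁰ L)))

theorem actClasses_mk (σ : L ≃ₐ[K] L) (I : (FractionalIdeal (𝓞 L)⁰ L)ˣ) :
    ClassGroup.mk L (actIdeals σ I) = actClasses σ (ClassGroup.mk L I) := by
  rw [actClasses, ClassGroup.mulEquiv, MulEquiv.trans_apply, MulEquiv.trans_apply,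
    MulEquiv.eq_symm_apply, ClassGroup.equiv_mk, ClassGroup.equiv_mk]
  change QuotientGroup.mk _ = QuotientGroup.mk _
  congr 1
  ext1
  change FractionalIdeal.canonicalEquiv (𝓞 L)⁰ L (FractionRing (𝓞 L))
    (FractionalIdeal.ringEquivOfRingEquiv L L (actIntegers σ) (I : FractionalIdeal (𝓞 L)⁰ L)) =
    FractionalIdeal.ringEquivOfRingEquiv _ _ (actIntegers σ)
      (FractionalIdeal.canonicalEquiv (𝓞 L)⁰ L (FractionRing (𝓞 L)) (I : FractionalIdeal (𝓞 L)⁰ L))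
  have hcan : ∀ J : FractionalIdeal (𝓞 L)⁰ L,
      FractionalIdeal.canonicalEquiv (𝓞 L)⁰ L (FractionRing (𝓞 L)) J =
        FractionalIdeal.ringEquivOfRingEquiv L (FractionRing (𝓞 L)) (RingEquiv.refl _) J := by
    intro J
    ext x
    rw [FractionalIdeal.mem_canonicalEquiv_apply]
    rfl
  rw [hcan, hcan, ← FractionalIdeal.ringEquivOfRingEquiv_trans_apply,
    ← FractionalIdeal.ringEquivOfRingEquiv_trans_apply]
  rfl

end Divisors

/-! ### Ideals prime to a finite set; primes with trivial decomposition group -/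

section Places

variable {K L : Type*} [Field K] [NumberField K] [Field L] [NumberField L] [Algebra K L]

theorem finite_finAbove (T : Finset (Place K)) : (finAbove L (T : Set (Place K))).Finite := by
  have h : finAbove L (T : Set (Place K)) ⊆ ⋃ p ∈ T, {w : FinPlace L | ∃ v, p = Sum.inl v ∧ Above w v} := by
    rintro w ⟨v, hv, hw⟩
    exact Set.mem_biUnion hv ⟨v, rfl, hw⟩
  refine (T.finite_toSet.biUnion fun p _ => ?_).subset h
  rcases p with v | v
  · refine Set.Finite.subset (Set.Finite.preimage (f := fun w : FinPlace L => w.asIdeal)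
      (fun w _ w' _ h => by ext1; exact h)
      (IsDedekindDomain.primesOver_finite v.asIdeal (𝓞 L))) ?_
    rintro w ⟨v', hv, hw⟩
    obtain rfl := Sum.inl_injective hv
    exact ⟨w.isPrime, ⟨hw.symm⟩⟩
  · refine Set.Finite.subset Set.finite_empty ?_
    rintro w ⟨v', hv, _⟩
    cases hv

theorem ord_eq_zero_of_not_le (w : FinPlace L) {I : Ideal (𝓞 L)} (hI : I ≠ 0) (h : ¬ I ≤ w.asIdeal) :
    FractionalIdeal.count L w (I : FractionalIdeal (𝓞 L)⁰ L) = 0 := by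
  classical
  rw [FractionalIdeal.count_coe L w hI]
  by_contra h0
  exact h (Ideal.le_of_dvd ((Associates.count_ne_zero_iff_dvd hI w.irreducible).mp
    (by exact_mod_cast h0)))

/-- Every ideal class contains an ideal that is prime to a given finite set of primes. -/
theorem exists_mk_eq_and_ord_eq_zero {B : Set (FinPlace L)} (hB : B.Finite) (C : ClassGroup (𝓞 L)) :
    ∃ I : (FractionalIdeal (𝓞 L)⁰ L)ˣ, ClassGroup.mk L I = C ∧ ∀ w ∈ B, ord w I = 0 := by
  -- The empty case is separate because `b ≠ 0` is deduced below from a prime in `B`.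
  rcases B.eq_empty_or_nonempty with rfl | ⟨w₀, hw₀⟩
  · obtain ⟨J, hJ⟩ := ClassGroup.mk0_surjective C
    exact ⟨FractionalIdeal.mk0 L J, by rw [ClassGroup.mk_mk0, hJ], by simp⟩
  · obtain ⟨J, hJ⟩ := ClassGroup.mk0_surjective C⁻¹
    have hJ0 : (J : Ideal (𝓞 L)) ≠ 0 := nonZeroDivisors.coe_ne_zero J
    set m : Ideal (𝓞 L) := ∏ w ∈ hB.toFinset, w.asIdeal with hm
    have hm0 : m ≠ 0 := Finset.prod_ne_zero_iff.mpr fun w _ => w.ne_bot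
    have hmw : ∀ w ∈ B, m ≤ w.asIdeal := fun w hw =>
      Ideal.le_of_dvd (Finset.dvd_prod_of_mem _ (hB.mem_toFinset.mpr hw))
    -- Here `J` lies in the class `C⁻¹` and `a` is chosen with `J = J m + (a)`. Writing `(a) = J b`
    -- gives `m + b = 1`, so `b` is prime to `B` and lies in the class `C`.
    obtain ⟨a, ha⟩ := IsDedekindDomain.exists_sup_span_eq
      (Ideal.mul_le_left : (J : Ideal (𝓞 L)) * m ≤ J) (mul_ne_zero hJ0 hm0)
    obtain ⟨b, hb⟩ : (J : Ideal (𝓞 L)) ∣ Ideal.span {a} :=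
      Ideal.dvd_iff_le.mpr (le_sup_right.trans ha.le)
    have hmb : m ⊔ b = ⊤ := by
      rw [hb, ← Ideal.mul_sup] at ha
      exact mul_left_cancel₀ hJ0 (ha.trans (Ideal.mul_top _).symm)
    have hbw : ∀ w ∈ B, ¬ b ≤ w.asIdeal := fun w hw hle =>
      w.isPrime.ne_top (top_le_iff.mp (hmb ▸ sup_le (hmw w hw) hle))
    have hb0 : b ≠ 0 := by
      rintro rfl
      exact hbw w₀ hw₀ bot_le
    refine ⟨FractionalIdeal.mk0 L ⟨b, mem_nonZeroDivisors_of_ne_zero hb0⟩, ?_, fun w hw => ?_⟩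
    · rw [ClassGroup.mk_mk0, ← inv_inv C, ← hJ, eq_inv_iff_mul_eq_one, mul_comm, ← map_mul]
      refine (ClassGroup.mk0_eq_one_iff _).mpr ⟨a, ?_⟩
      exact hb.symm
    · exact ord_eq_zero_of_not_le w hb0 (hbw w hw)

theorem exists_integer_smul_ne [IsGalois K L] : ∃ θ : 𝓞 L, θ ≠ 0 ∧ ∀ σ : L ≃ₐ[K] L, σ ≠ 1 → σ • θ ≠ θ := by
  obtain ⟨α, hα⟩ := Field.exists_primitive_element K L
  have halg : IsAlgebraic ℤ α :=
    (IsFractionRing.isAlgebraic_iff ℤ ℚ L).mpr (Algebra.IsAlgebraic.isAlgebraic α)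
  obtain ⟨y, hy, hint⟩ := halg.exists_integral_multiple
  let β : 𝓞 L := ⟨y • α, hint⟩
  have hβ : ∀ σ : L ≃ₐ[K] L, σ • β = β → σ = 1 := by
    intro σ h
    have h1 : σ (y • α) = y • α := congrArg (fun b : 𝓞 L => (b : L)) h
    rw [map_zsmul] at h1
    have h2 : σ α = α := smul_right_injective L hy h1
    have h3 : Subgroup.zpowers σ ≤ MulAction.stabilizer (L ≃ₐ[K] L) α :=
      Subgroup.zpowers_le.mpr h2
    have h4 : K⟮α⟯ ≤ IntermediateField.fixedField (Subgroup.zpowers σ) :=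
      IntermediateField.adjoin_simple_le_iff.mpr fun g => h3 g.2
    ext x
    exact h4 (hα ▸ IntermediateField.mem_top : x ∈ K⟮α⟯) ⟨σ, Subgroup.mem_zpowers σ⟩
  -- If `β = 0`, then every `σ` fixes `β` and so `G` is trivial; any non-zero `θ` will do.
  by_cases hβ0 : β = 0
  · exact ⟨1, one_ne_zero, fun σ hσ => absurd (hβ σ (by rw [hβ0, smul_zero])) hσ⟩
  · exact ⟨β, hβ0, fun σ hσ h => hσ (hβ σ h)⟩

/-- For large `m` every complex embedding of `1 - m N θ` has absolute value above `1`, hence so does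
the norm. A prime containing this element cannot contain `N`. -/
theorem exists_not_isUnit (θ : 𝓞 L) (hθ : θ ≠ 0) (N : ℕ) (hN : N ≠ 0) :
    ∃ m : ℕ, 1 - (m : 𝓞 L) * N * θ ≠ 0 ∧ ¬ IsUnit (1 - (m : 𝓞 L) * N * θ) := by
  have h1 : ∀ φ : L →ₐ[ℚ] ℂ, ∀ᶠ m : ℕ in Filter.atTop, 1 < ‖φ ((1 - (m : 𝓞 L) * N * θ : 𝓞 L) : L)‖ := by
    intro φ
    have hpos : 0 < (N : ℝ) * ‖φ (θ : L)‖ := by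
      have : φ (θ : L) ≠ 0 := by simpa using hθ
      positivity
    have := (tendsto_natCast_atTop_atTop (R := ℝ)).atTop_mul_const hpos
    filter_upwards [this.eventually_gt_atTop 2] with m hm
    have h2 : φ ((1 - (m : 𝓞 L) * N * θ : 𝓞 L) : L) = 1 - (m : ℂ) * N * φ (θ : L) := by
      simp
    rw [h2]
    have h3 := norm_sub_norm_le ((m : ℂ) * N * φ (θ : L)) 1
    rw [norm_sub_rev, norm_mul, norm_mul, Complex.norm_natCast, Complex.norm_natCast, norm_one,
      mul_assoc] at h3
    linarith
  obtain ⟨m, hm⟩ := (Filter.eventually_all.mpr h1).exists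
  have hnorm : 1 < ‖algebraMap ℚ ℂ (Algebra.norm ℚ ((1 - (m : 𝓞 L) * N * θ : 𝓞 L) : L))‖ := by
    rw [Algebra.norm_eq_prod_embeddings, norm_prod]
    rw [← Finset.prod_const_one (s := (Finset.univ : Finset (L →ₐ[ℚ] ℂ)))]
    exact Finset.prod_lt_prod_of_nonempty (fun _ _ => one_pos) (fun φ _ => hm φ)
      ⟨IsAlgClosed.lift, Finset.mem_univ _⟩
  refine ⟨m, fun h0 => ?_, fun hu => ?_⟩
  · rw [h0] at hnorm
    simp at hnorm
    linarith
  · rw [NumberField.isUnit_iff_norm] at hu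
    have h4 : ‖algebraMap ℚ ℂ (Algebra.norm ℚ ((1 - (m : 𝓞 L) * N * θ : 𝓞 L) : L))‖ = 1 := by
      rw [RingOfIntegers.coe_norm] at hu
      rw [eq_ratCast, Complex.norm_ratCast, ← Rat.cast_abs, hu, Rat.cast_one]
    linarith

/-- Outside of a given finite set of primes, there is a prime of `L` with trivial decomposition
group over `K`. -/
theorem exists_actPlace_ne [IsGalois K L] {B : Set (FinPlace L)} (hB : B.Finite) :
    ∃ w ∉ B, ∀ σ : L ≃ₐ[K] L, actPlace σ w = w → σ = 1 := by
  classical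
  obtain ⟨θ, hθ, hσ⟩ := exists_integer_smul_ne (K := K) (L := L)
  set D : 𝓞 L := ∏ σ ∈ (Finset.univ : Finset (L ≃ₐ[K] L)).erase 1, (σ • θ - θ) with hD
  have hD0 : D ≠ 0 := Finset.prod_ne_zero_iff.mpr fun σ h =>
    sub_ne_zero.mpr (hσ σ (Finset.ne_of_mem_erase h))
  -- A prime that does not contain `N` is outside `B` and does not contain the product `D` of the
  -- differences `σθ - θ`.
  set N : ℕ := Ideal.absNorm (Ideal.span {D}) * ∏ w ∈ hB.toFinset, Ideal.absNorm w.asIdeal with hNdef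
  have hN : N ≠ 0 := by
    refine mul_ne_zero ?_ (Finset.prod_ne_zero_iff.mpr fun w _ => ?_)
    · rw [Ne, Ideal.absNorm_eq_zero_iff]
      simpa using hD0
    · rw [Ne, Ideal.absNorm_eq_zero_iff]
      exact w.ne_bot
  obtain ⟨m, hu0, hu⟩ := exists_not_isUnit θ hθ N hN
  obtain ⟨P, hP, huP⟩ := exists_max_ideal_of_mem_nonunits hu
  let w : FinPlace L := ⟨P, hP.isPrime, fun h => hu0 (by rw [h] at huP; simpa using huP)⟩
  have hmN : (m : 𝓞 L) * N ∉ P := fun h => by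
    have := P.add_mem huP (P.mul_mem_right θ h)
    rw [sub_add_cancel] at this
    exact hP.ne_top ((Ideal.eq_top_iff_one _).mpr this)
  have hNP : (N : 𝓞 L) ∉ P := fun h => hmN (P.mul_mem_left _ h)
  refine ⟨w, fun hw => hNP ?_, fun σ hσw => ?_⟩
  · rw [hNdef, Nat.cast_mul, Nat.cast_prod]
    refine P.mul_mem_left _ (Ideal.mem_of_dvd P (Finset.dvd_prod_of_mem _ (hB.mem_toFinset.mpr hw)) ?_)
    exact Ideal.absNorm_mem P
  · by_contra hne
    -- If `σ` fixes `P`, subtracting the conjugate of `1 - m N θ` gives `m N (σθ - θ) ∈ P`, so `D ∈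
    -- P` and therefore `N ∈ P`, a contradiction.
    have hsP : σ • P = P := by
      rw [show P = w.asIdeal from rfl, ← asIdeal_actPlace, hσw]
    have h1 := Ideal.smul_mem_pointwise_smul σ _ _ huP
    rw [hsP] at h1
    have h2 := P.sub_mem huP h1
    have h3 : 1 - (m : 𝓞 L) * N * θ - σ • (1 - (m : 𝓞 L) * N * θ) = (m : 𝓞 L) * N * (σ • θ - θ) := by
      have hcast : ∀ k : ℕ, σ • (k : 𝓞 L) = k := fun k =>
        map_natCast (MulSemiringAction.toRingHom (L ≃ₐ[K] L) (𝓞 L) σ) k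
      rw [smul_sub, smul_one, smul_mul', smul_mul', hcast, hcast]
      ring
    rw [h3] at h2
    have h4 : σ • θ - θ ∈ P := (hP.isPrime.mem_or_mem h2).resolve_left hmN
    have h5 : D ∈ P := Ideal.mem_of_dvd P
      (Finset.dvd_prod_of_mem _ (Finset.mem_erase.mpr ⟨hne, Finset.mem_univ _⟩)) h4
    have h6 : (Ideal.absNorm (Ideal.span {D}) : 𝓞 L) ∈ P :=
      (P.span_singleton_le_iff_mem.mpr h5) (Ideal.absNorm_mem _)
    exact hNP (by rw [hNdef, Nat.cast_mul]; exact P.mul_mem_right _ h6)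

end Places

/-! ### Group ring exponents on ideals and the module generated by a prime -/

section IdealActions

variable {K L : Type*} [Field K] [NumberField K] [Field L] [NumberField L] [Algebra K L]

theorem ord_actIdeals' (σ : L ≃ₐ[K] L) (w : FinPlace L) (I : (FractionalIdeal (𝓞 L)⁰ L)ˣ) :
    ord w (actIdeals σ I) = ord (actPlace σ⁻¹ w) I := by
  have h := ord_actIdeals σ (actPlace σ⁻¹ w) I
  rwa [← actPlace_mul, mul_inv_cancel, actPlace_one] at h

theorem actIdeals_mul (σ τ : L ≃ₐ[K] L) (I : (FractionalIdeal (𝓞 L)⁰ L)ˣ) :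
    actIdeals (σ * τ) I = actIdeals σ (actIdeals τ I) :=
  ext_ord fun w => by
    rw [ord_actIdeals', ord_actIdeals', ord_actIdeals', mul_inv_rev, actPlace_mul]

theorem actIdeals_one (I : (FractionalIdeal (𝓞 L)⁰ L)ˣ) : actIdeals (1 : L ≃ₐ[K] L) I = I :=
  ext_ord fun w => by rw [ord_actIdeals', inv_one, actPlace_one]

theorem ord_groupRingPow (w : FinPlace L) (I : (FractionalIdeal (𝓞 L)⁰ L)ˣ)
    (c : ℤ[L ≃ₐ[K] L]) :
    ord w (groupRingPow actIdeals I c) =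
      ∑ g : L ≃ₐ[K] L, c.coeff g * ord (actPlace g⁻¹ w) I := by
  classical
  have h : ∀ s : Finset (L ≃ₐ[K] L), ord w (∏ g ∈ s, actIdeals g I ^ c.coeff g) =
      ∑ g ∈ s, c.coeff g * ord (actPlace g⁻¹ w) I := by
    intro s
    induction s using Finset.induction_on with
    | empty => simp [ord, FractionalIdeal.count_one]
    | insert g s hg ih =>
      rw [Finset.prod_insert hg, Finset.sum_insert hg, ord_mul, ih, ord_zpow, ord_actIdeals']
  exact h _

theorem ord_groupRingPow_eq_zero {T : Set (Place K)} {I : (FractionalIdeal (𝓞 L)⁰ L)ˣ}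
    (hI : ∀ w ∈ finAbove L T, ord w I = 0) (c : ℤ[L ≃ₐ[K] L]) :
    ∀ w ∈ finAbove L T, ord w (groupRingPow actIdeals I c) = 0 := by
  rintro w ⟨v, hv, hw⟩
  rw [ord_groupRingPow]
  refine Finset.sum_eq_zero fun g _ => ?_
  rw [hI _ ⟨v, hv, above_actPlace hw g⁻¹⟩, mul_zero]

/-- If the support of `ε` is disjoint from `T`, then `S` may be enlarged by this support. -/
theorem Hyp.union_supportBelow {S : Set (Place K)} {T : Set (Place K)} (h : Hyp L S T) {ε : Lˣ}
    (hε : ∀ w ∈ finAbove L T, ord w (toPrincipalIdeal (𝓞 L) L ε) = 0) :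
    Hyp L (S ∪ supportBelow K ε) T := by
  obtain ⟨h1, h2, h3⟩ := h
  refine ⟨h1.trans Set.subset_union_left, Set.disjoint_union_left.mpr ⟨h2, ?_⟩, fun x hx hfin => ?_⟩
  · rw [Set.disjoint_left]
    rintro _ ⟨v, rfl, w, hw, hval⟩ hv
    exact hval ((valuation_eq_one_iff w ε).mpr (hε w ⟨v, hv, hw⟩))
  · refine h3 x ⟨fun w _ => ?_, hx.2⟩ hfin
    -- A torsion element generates the trivial ideal, so it is a unit everywhere and enlarging `S`
    -- creates no new torsion.
    obtain ⟨n, hn, hxn⟩ := isOfFinOrder_iff_pow_eq_one.mp hfin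
    have h4 : toPrincipalIdeal (𝓞 L) L x = 1 := eq_of_pow_eq_pow hn.ne' (by
      rw [← map_pow, hxn, map_one, one_pow])
    rw [valuation_eq_one_iff, h4]
    simp [ord, FractionalIdeal.count_one]

theorem mk_toPrincipalIdeal (x : Lˣ) : ClassGroup.mk L (toPrincipalIdeal (𝓞 L) L x) = 1 := by
  rw [ClassGroup.mk_eq_one_iff, coe_toPrincipalIdeal]
  exact ⟨(x : L), by rw [FractionalIdeal.coe_spanSingleton]⟩

/-- A prime ideal as an invertible fractional ideal. -/
def primeIdeal (w : FinPlace L) : (FractionalIdeal (𝓞 L)⁰ L)ˣ :=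
  FractionalIdeal.mk0 L ⟨w.asIdeal, mem_nonZeroDivisors_of_ne_zero w.ne_bot⟩

open Classical in
theorem ord_primeIdeal (w w' : FinPlace L) : ord w (primeIdeal w') = if w = w' then 1 else 0 := by
  rw [ord, primeIdeal, FractionalIdeal.coe_mk0, FractionalIdeal.count_maximal]
  simp [eq_comm]

/-- With trivial decomposition group the primes `g w` are pairwise distinct, so an exponent can be
read off from the multiplicities: `w` generates a free `ℤ[G]`-module. -/
theorem ord_primeIdeal_groupRingPow {w : FinPlace L}
    (hw : ∀ σ : L ≃ₐ[K] L, actPlace σ w = w → σ = 1) (c : ℤ[L ≃ₐ[K] L]) (g : L ≃ₐ[K] L) :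
    ord (actPlace g w) (groupRingPow actIdeals (primeIdeal w) c) = c.coeff g := by
  classical
  rw [ord_groupRingPow, Finset.sum_eq_single g]
  · rw [← actPlace_mul, inv_mul_cancel, actPlace_one, ord_primeIdeal, if_pos rfl, mul_one]
  · intro h _ hne
    rw [← actPlace_mul, ord_primeIdeal, if_neg, mul_zero]
    intro h1
    exact hne (inv_mul_eq_one.mp (hw _ h1))
  · simp

theorem ord_primeIdeal_groupRingPow_of_ne {w w' : FinPlace L}
    (hw : ∀ σ : L ≃ₐ[K] L, w' ≠ actPlace σ w) (c : ℤ[L ≃ₐ[K] L]) :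
    ord w' (groupRingPow actIdeals (primeIdeal w) c) = 0 := by
  classical
  rw [ord_groupRingPow]
  refine Finset.sum_eq_zero fun g _ => ?_
  rw [ord_primeIdeal, if_neg, mul_zero]
  intro h
  apply hw g
  rw [← h, ← actPlace_mul, mul_inv_cancel, actPlace_one]

theorem groupRingPow_primeIdeal_injective {w : FinPlace L}
    (hw : ∀ σ : L ≃ₐ[K] L, actPlace σ w = w → σ = 1) {c d : ℤ[L ≃ₐ[K] L]}
    (h : groupRingPow actIdeals (primeIdeal w) c = groupRingPow actIdeals (primeIdeal w) d) :
    c = d := by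
  ext g
  rw [← ord_primeIdeal_groupRingPow hw, h, ord_primeIdeal_groupRingPow hw]

/-- Since `(ε) = w^c` involves only conjugates of `w`, the set `S_ε` contains at most the place
below `w`. The Galois group is transitive on the primes above it, so an `S_ε`-unit is supported on
the orbit of `w`. -/
theorem exists_groupRingPow_primeIdeal_eq [IsGalois K L] {w : FinPlace L}
    (hw : ∀ σ : L ≃ₐ[K] L, actPlace σ w = w → σ = 1) {c : ℤ[L ≃ₐ[K] L]} {ε η : Lˣ}
    (hε : groupRingPow actIdeals (primeIdeal w) c = toPrincipalIdeal (𝓞 L) L ε)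
    {T : Set (Place K)} (hη : η ∈ stUnits L (supportBelow K ε) T) :
    ∃ y : ℤ[L ≃ₐ[K] L], groupRingPow actIdeals (primeIdeal w) y = toPrincipalIdeal (𝓞 L) L η := by
  let f : (L ≃ₐ[K] L) →₀ ℤ :=
    Finsupp.equivFunOnFinite.symm fun g => ord (actPlace g w) (toPrincipalIdeal (𝓞 L) L η)
  refine ⟨MonoidAlgebra.ofCoeff f, ext_ord fun w' => ?_⟩
  by_cases hw' : ∃ σ : L ≃ₐ[K] L, w' = actPlace σ w
  · obtain ⟨σ, rfl⟩ := hw'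
    rw [ord_primeIdeal_groupRingPow hw]
    rfl
  · rw [ord_primeIdeal_groupRingPow_of_ne (fun σ h => hw' ⟨σ, h⟩)]
    symm
    rw [← valuation_eq_one_iff]
    refine hη.1 w' ?_
    rintro ⟨_, ⟨v, hv, u, huv, hu⟩, hw'v⟩
    obtain rfl := Sum.inl_injective hv
    rw [Ne, valuation_eq_one_iff, ← hε] at hu
    have hex : ∃ σ : L ≃ₐ[K] L, u = actPlace σ w := by
      by_contra hne
      exact hu (ord_primeIdeal_groupRingPow_of_ne (fun σ h => hne ⟨σ, h⟩) c)
    obtain ⟨σ, rfl⟩ := hex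
    obtain ⟨τ, rfl⟩ := exists_actPlace_eq huv hw'v
    exact hw' ⟨τ * σ, (actPlace_mul _ _ _).symm⟩

end IdealActions

/-! ### From Brumer–Stark to Brumer -/

section Main

variable {K L : Type*} [Field K] [NumberField K] [Field L] [NumberField L] [Algebra K L]
  [IsGalois K L]

theorem mul_mem_classGroupAnnihilator {r c : ℤ[L ≃ₐ[K] L]}
    (hr : r ∈ Subring.center ℤ[L ≃ₐ[K] L]) (hc : c ∈ classGroupAnnihilator K L) :
    r * c ∈ classGroupAnnihilator K L := by
  refine ⟨Subring.mul_mem _ hr hc.1, fun a => ?_⟩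
  obtain ⟨I, rfl, -⟩ := exists_mk_eq_and_ord_eq_zero (L := L) Set.finite_empty a
  rw [← map_groupRingPow (act := actIdeals) (ClassGroup.mk L) (fun σ I => actClasses_mk σ I),
    groupRingPow_mul actIdeals_mul, map_groupRingPow (ClassGroup.mk L)
      (fun σ I => actClasses_mk σ I), map_groupRingPow (ClassGroup.mk L)
      (fun σ I => actClasses_mk σ I), hc.2, groupRingPow_one_base]

variable [NumberField.IsCMField L]

theorem BrumerStarkFor.exists_mem_classGroupAnnihilator {X : Set ℂ[L ≃ₐ[K] L]} {S : Set (Place K)}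
    {n : ℕ} (hn : n ≠ 0) (hX : ∀ k : ℕ, ((n * k : ℕ) : ℂ[L ≃ₐ[K] L]) ∈ X)
    (hBS : BrumerStarkFor L X S) {x : ℂ[L ≃ₐ[K] L]} (hx : x ∈ X) {T : Finset (Place K)}
    (hT : Hyp L S (T : Set (Place K))) :
    ∃ y ∈ classGroupAnnihilator K L,
      intToComplex _ y = x * (delta L T 0 * stickelberger L S ∅) := by
  set θ := stickelberger L S ∅
  obtain ⟨c, hc, hcx, hBS⟩ := hBS x hx
  obtain ⟨n₁, hn₁, e₁, he₁⟩ := exists_natCast_mul_mem_range_intToComplex (delta_mem_range (L := L) T)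
  obtain ⟨n₂, hn₂, e₂, he₂⟩ := exists_natCast_mul_mem_range_intToComplex (omega_mem_range K L)
  obtain ⟨u, hu, huω⟩ := exists_omega_inv K L
  obtain ⟨n₃, hn₃, d₃, hd₃⟩ := exists_natCast_mul_mem_range_intToComplex hu
  -- A multiple of `n`, hence an element of `X`, that clears the denominators of both `δ_T(0)` and
  -- `ω_L`.
  set N := n * (n₁ * n₂) with hN
  set z : ℂ[L ≃ₐ[K] L] := ((N : ℕ) : ℂ[L ≃ₐ[K] L]) with hz
  have hzX : z ∈ X := hX _
  obtain ⟨d₁, hd₁⟩ : ∃ d₁ : ℤ[L ≃ₐ[K] L], intToComplex _ d₁ = z * delta L T 0 := by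
    refine ⟨((n * n₂ : ℕ) : ℤ[L ≃ₐ[K] L]) * e₁, ?_⟩
    rw [map_mul, map_natCast, he₁, ← mul_assoc, ← Nat.cast_mul, hz, hN]
    congr 2
    ring
  obtain ⟨d₂, hd₂⟩ : ∃ d₂ : ℤ[L ≃ₐ[K] L], intToComplex _ d₂ = z * omega K L := by
    refine ⟨((n * n₁ : ℕ) : ℤ[L ≃ₐ[K] L]) * e₂, ?_⟩
    rw [map_mul, map_natCast, he₂, ← mul_assoc, ← Nat.cast_mul, hz, hN]
    congr 2
    ring
  have hzc : ∀ a : ℂ[L ≃ₐ[K] L], a * z = z * a := fun a => (Nat.cast_commute N a).eq.symm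
  set M := n₃ * N with hM
  have hM0 : M ≠ 0 := mul_ne_zero hn₃ (mul_ne_zero hn (mul_ne_zero hn₁ hn₂))
  -- Multiplying by `d₃ = n₃ ω_L⁻¹` turns the exponent `d₂` into a positive integer, so that
  -- torsion-freeness of the ideal group can be used at the end.
  have hd₃₂ : d₃ * d₂ = (M : ℤ[L ≃ₐ[K] L]) := by
    apply intToComplex_injective
    rw [map_mul, hd₃, hd₂, map_natCast, mul_assoc, ← mul_assoc u, hzc, mul_assoc, huω, mul_one, hM,
      Nat.cast_mul]
  -- the relation obtained from an ideal prime to `T`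
  have core : ∀ I : (FractionalIdeal (𝓞 L)⁰ L)ˣ,
      (∀ w ∈ finAbove L (T : Set (Place K)), ord w I = 0) →
      ∃ ε εT : Lˣ, groupRingPow actIdeals I c = toPrincipalIdeal (𝓞 L) L ε ∧
        εT ∈ stUnits L (supportBelow K ε) (T : Set (Place K)) ∧
        groupRingPow actIdeals I (d₁ * c) =
          groupRingPow actIdeals (toPrincipalIdeal (𝓞 L) L εT) d₂ := by
    intro I hI
    obtain ⟨ε, -, hε, hεT⟩ := hBS I
    obtain ⟨εT, hmem, h⟩ := hεT T (hT.union_supportBelow (by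
      rw [← hε]; exact ord_groupRingPow_eq_zero hI c))
    refine ⟨ε, εT, hε, hmem, ?_⟩
    rw [groupRingPow_mul actIdeals_mul, hε,
      ← map_groupRingPow (act := actUnits) (toPrincipalIdeal (𝓞 L) L)
        (fun σ x => (actIdeals_toPrincipalIdeal σ x).symm), h z hzX d₁ d₂ hd₁ hd₂,
      map_groupRingPow (act' := actIdeals) (toPrincipalIdeal (𝓞 L) L)
        (fun σ x => (actIdeals_toPrincipalIdeal σ x).symm)]
  obtain ⟨w, hwT, hw⟩ := exists_actPlace_ne (K := K) (finite_finAbove (L := L) T)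
  obtain ⟨ε, εT, hε, hεT, hrel⟩ := core (primeIdeal w) fun w' hw' => by
    classical
    rw [ord_primeIdeal, if_neg]
    rintro rfl
    exact hwT hw'
  obtain ⟨y, hy⟩ := exists_groupRingPow_primeIdeal_eq hw hε hεT
  -- Both sides are exponents of the free generator `w` that yield the same ideal.
  have hdy : d₁ * c = d₂ * y := groupRingPow_primeIdeal_injective hw <| hrel.trans <| by
    rw [← hy]
    exact (groupRingPow_mul actIdeals_mul _ d₂ y).symm
  have hωy : omega K L * intToComplex _ y = delta L T 0 * intToComplex _ c := by
    have h := congrArg (intToComplex _) hdy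
    rw [map_mul, map_mul, hd₁, hd₂, mul_assoc, mul_assoc, hz, ← nsmul_eq_mul, ← nsmul_eq_mul] at h
    exact (smul_right_injective _ (mul_ne_zero hn (mul_ne_zero hn₁ hn₂)) h).symm
  have hcancel : ∀ a b : ℂ[L ≃ₐ[K] L], omega K L * a = omega K L * b → a = b := by
    intro a b h
    rw [← one_mul a, ← huω, mul_assoc, h, ← mul_assoc, huω, one_mul]
  have hyx : intToComplex _ y = x * (delta L T 0 * θ) := by
    apply hcancel
    rw [hωy, hcx, ← mul_assoc x, ← delta_comm, mul_assoc (delta L T 0) x θ, mul_assoc x, omega_comm θ,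
      ← mul_assoc x, omega_comm, mul_assoc (delta L T 0)]
  refine ⟨y, ⟨?_, fun C => ?_⟩, hyx⟩
  -- Centrality is tested after multiplication by the central unit `ω_L`, where `ω_L y = δ_T(0) c`
  -- is a product of central elements.
  · rw [Subring.mem_center_iff]
    intro r
    apply intToComplex_injective
    apply hcancel
    have hcr : intToComplex _ c * intToComplex _ r = intToComplex _ r * intToComplex _ c := by
      rw [← map_mul, ← map_mul, Subring.mem_center_iff.mp hc r]
    rw [map_mul, map_mul, ← mul_assoc, omega_comm (intToComplex _ r), mul_assoc, hωy, ← mul_assoc,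
      ← delta_comm, mul_assoc, ← hcr, ← mul_assoc, ← hωy, mul_assoc]
  · obtain ⟨I, rfl, hI⟩ := exists_mk_eq_and_ord_eq_zero (finite_finAbove (L := L) T) C
    obtain ⟨-, η, -, -, hη⟩ := core I hI
    rw [hdy, groupRingPow_mul actIdeals_mul] at hη
    -- Raise `(I^y)^{d₂} = (η)^{d₂}` to the exponent `d₃`.
    have h1 : groupRingPow actIdeals I y ^ M = toPrincipalIdeal (𝓞 L) L η ^ M := by
      rw [← groupRingPow_natCast (actIdeals_one (K := K) (L := L)),
        ← groupRingPow_natCast (actIdeals_one (K := K) (L := L)), ← hd₃₂,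
        groupRingPow_mul actIdeals_mul, groupRingPow_mul actIdeals_mul, hη]
    rw [← map_groupRingPow (act := actIdeals) (ClassGroup.mk L) (fun σ I => actClasses_mk σ I),
      eq_of_pow_eq_pow hM0 h1, mk_toPrincipalIdeal]

/-- The conclusion is stable under sums and under multiplication by `ζ(ℤ[G])`, so it suffices to
treat the generators `δ_T(0)` of `𝔄_S`. -/
theorem BrumerStarkFor.brumerFor {X : Set ℂ[L ≃ₐ[K] L]} {S : Set (Place K)} {n : ℕ} (hn : n ≠ 0)
    (hX : ∀ k : ℕ, ((n * k : ℕ) : ℂ[L ≃ₐ[K] L]) ∈ X) (hBS : BrumerStarkFor L X S) :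
    BrumerFor L X S := by
  intro x hx a ha
  induction ha using Submodule.span_induction with
  | mem a ha =>
    obtain ⟨T, hT, rfl⟩ := ha
    exact hBS.exists_mem_classGroupAnnihilator hn hX hx hT
  | zero =>
    exact ⟨0, ⟨Subring.zero_mem _, fun a => groupRingPow_zero a⟩, by simp⟩
  | add a b _ _ iha ihb =>
    obtain ⟨c, hc, hca⟩ := iha
    obtain ⟨d, hd, hdb⟩ := ihb
    refine ⟨c + d, ⟨Subring.add_mem _ hc.1 hd.1, fun A => ?_⟩, ?_⟩
    · rw [groupRingPow_add, hc.2, hd.2, mul_one]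
    · rw [map_add, hca, hdb, add_mul, mul_add]
  | smul r a _ iha =>
    obtain ⟨c, hc, hca⟩ := iha
    obtain ⟨_, r', hr', rfl⟩ := r
    refine ⟨r' * c, mul_mem_classGroupAnnihilator hr' hc, ?_⟩
    have hcomm : ∀ b : ℂ[L ≃ₐ[K] L], intToComplex _ r' * b = b * intToComplex _ r' := by
      intro b
      induction b using MonoidAlgebra.induction_linear with
      | zero => simp
      | add a b ha hb => rw [mul_add, add_mul, ha, hb]
      | single g s =>
        have h1 := congrArg (intToComplex _)
          (Subring.mem_center_iff.mp hr' (MonoidAlgebra.single g 1))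
        rw [map_mul, map_mul] at h1
        have h2 : (MonoidAlgebra.single g s : ℂ[L ≃ₐ[K] L]) =
            s • intToComplex _ (MonoidAlgebra.single g 1) := by
          simp [intToComplex]
        rw [h2, mul_smul_comm, smul_mul_assoc, h1]
    rw [map_mul, hca, ← mul_assoc, hcomm x, mul_assoc]
    congr 1
    exact (mul_assoc _ _ _).symm

end Main

end NonabelianBrumer

end

theorem mainTheorem2 {K L : Type*} [Field K] [NumberField K] [Field L] [NumberField L]
    [Algebra K L] [IsGalois K L] [NumberField.IsTotallyReal K] [NumberField.IsCMField L]
    (S : Set (NonabelianBrumer.Place K)) (hfin : S.Finite)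
    (hS : NonabelianBrumer.ramifiedOrInfinite K L ⊆ S) :
    (NonabelianBrumer.BrumerStark L S → NonabelianBrumer.Brumer L S) ∧
    ∀ M : Subring (MonoidAlgebra ℚ (L ≃ₐ[K] L)), NonabelianBrumer.IsMaximalOrderOver M →
      (NonabelianBrumer.WeakBrumerStark L M S → NonabelianBrumer.WeakBrumer L M S) := by
  -- The required integer is `|G|` for `𝓗(G)`; for `𝓕(G)` it exists because `M` is finitely
  -- generated over `ℤ`.
  refine ⟨fun h => NonabelianBrumer.BrumerStarkFor.brumerFor Fintype.card_ne_zero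
    NonabelianBrumer.natCast_mem_denominatorIdeal h, fun M hM h => ?_⟩
  obtain ⟨n, hn, hX⟩ := NonabelianBrumer.exists_natCast_mem_centralConductor hM.1.1
  exact NonabelianBrumer.BrumerStarkFor.brumerFor hn hX h
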